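/- Let $\mathcal Z=\mathcal X\times\mathcal Y$ with $\mathcal Y=\{1,\dots,c\}$, let $P$ be any probability distribution on $\mathcal Z$, and let $\mathcal D$ consist of $m\ge 1$ training samples $(\widetilde X_j,\widetilde Y_j)$, $j\in[m]$, and $n\ge 1$ calibration samples $(X_i,Y_i)$, $i\in[n]$, all i.i.d. with law $P$. Let $S:\mathcal X\times\mathcal Y\to\mathbb R$ be any conformal score constructed from the training samples. Let $\mathcal H$ be an RKHS of real-valued functions on $\mathcal Z$ with a (measurable) kernel $K$ satisfying $0\le K(z,z')\le\kappa^2$ for all $z,z'\in\mathcal Z$, where $\kappa\ge 0$. Let $\mathbf w=(w_i(y))_{i\in[n],y\in\mathcal Y}$ be an exact solution of the kernel quadratic program $$\min_{\mathbf w}\ \Big(\tfrac1{n^2}\mathbf w^\top\mathbf K\mathbf w-\tfrac2{nm}\mathbf v^\top\mathbf w+\tfrac1{m^2}\mathbf 1^\top\widetilde{\mathbf K}\mathbf 1\Big)^{1/2}\quad\text{s.t. } \mathbf w\succeq 0,\ \sum_{y\in\mathcal Y}w_i(y)=1\ (i\in[n]),\ \mathbf B\mathbf w\preceq\mathbf b,$$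 where $\mathbf K$ is the kernel matrix of the $nc$ pairs $(X_i,y)$, $\widetilde{\mathbf K}$ is the kernel matrix of the training samples, $\mathbf v$ has entries $v_{(i,y)}=\sum_{j\in[m]}K\big((X_i,y),(\widetilde X_j,\widetilde Y_j)\big)$, and the matrix $\mathbf B$ and vector $\mathbf b$ (which may depend on the data) are such that the true-label weights $w_i^*(y)=\mathbb I\{y=Y_i\}$ are feasible. For $\alpha\in[0,1]$ let $$\widehat q=\inf\Big\{q\in\mathbb R:\ \tfrac1n\sum_{i\in[n],y\in\mathcal Y}w_i(y)\,\mathbb I\{S(X_i,y)\le q\}\ge(1-\alpha)\big(1+\tfrac1n\big)\Big\}\in[-\infty,+\infty],$$ $\mathcal C(x)=\{y\in\mathcal Y: S(x,y)\le\widehat q\}$ and $\mathfrak X_{\mathcal C}(x,y)=\mathbb I\{y\in\mathcal C(x)\}$. Let $(X,Y)\sim P$ be a test pair independent of $\mathcal D$, so that $\mathbb P\{Y\in\mathcal C(X)\mid\mathcal D\}$ is the $P$-probability of $\{(x,y):y\in\mathcal C(x)\}$ for the realized rule $\mathcal C$. Let $\delta\in(0,1)$ and $$G^K_{n,m}=\min_{f\in\mathcal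 H}\Big[\frac1n\sum_{i\in[n],y\in\mathcal Y}\big|\mathfrak X_{\mathcal C}(X_i,y)-f(X_i,y)\big|+2\kappa\big(1+\sqrt{\log(2/\delta)}\big)\sqrt{\tfrac1n+\tfrac1m}\,\|f\|_{\mathcal H}\Big].$$ This minimum is attained, and it equals the optimal bias-variance trade-off over all radii, $$G^K_{n,m}=\inf_{R>0}\Big[\inf_{\|f\|_{\mathcal H}\le R}\frac1n\sum_{i\in[n],y\in\mathcal Y}\big|\mathfrak X_{\mathcal C}(X_i,y)-f(X_i,y)\big|+2\kappa\big(1+\sqrt{\log(2/\delta)}\big)\sqrt{\tfrac1n+\tfrac1m}\,R\Big].$$ With probability at least $1-\delta$, $$\mathbb P\{Y\in\mathcal C(X)\mid\mathcal D\}\ \ge\ 1-\alpha-G^K_{n,m}-\sqrt{\frac{\log(2/\delta)}{2n}}.$$ If in addition the values $\{S(X_i,y)\}_{(i,y)\in[n]\times\mathcal Y}$ are distinct with probability one, then with probability at least $1-\delta$, $$\mathbb P\{Y\in\mathcal C(X)\mid\mathcal D\}\ \le\ 1-\alpha+\frac2{n+1}+G^K_{n,m}+\sqrt{\frac{\log(2/\delta)}{2n}}.$$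 -/

import Mathlib

open MeasureTheory ProbabilityTheory
open scoped ENNReal

noncomputable section

namespace UnsupConformal

/-- The `β`-quantile of the values `s i` with probabilities `p i`:
`inf {q ∈ ℝ : ∑ i, p i * 𝟙{s i ≤ q} ≥ β}`. It is valued in the extended reals, so that it is
`-∞` when every real `q` qualifies and `+∞` when none does. -/
def quantile {ι : Type*} [Fintype ι] (s p : ι → ℝ) (β : ℝ) : EReal :=
  sInf ((fun q : ℝ => (q : EReal)) '' {q : ℝ | β ≤ ∑ i, p i * (if s i ≤ q then 1 else 0)})

section SplitConformal

variable {𝒳 : Type*} {n m c r : ℕ}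

/-- The conformal quantile computed from unlabeled calibration instances `x` and label weights
`w`, at level `(1 - α)(1 + 1/n)`. -/
def conformalQuantile (α : ℝ) (S : 𝒳 × Fin c → ℝ) (x : Fin n → 𝒳) (w : Fin n × Fin c → ℝ) :
    EReal :=
  quantile (fun p : Fin n × Fin c => S (x p.1, p.2)) (fun p => w p / n)
    ((1 - α) * (1 + 1 / (n : ℝ)))

/-- The set-prediction rule of split conformal prediction with unsupervised calibration. -/
def predictionSet (α : ℝ) (S : 𝒳 × Fin c → ℝ) (x : Fin n → 𝒳) (w : Fin n × Fin c → ℝ) :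
    𝒳 → Set (Fin c) :=
  fun x₀ => {y | (S (x₀, y) : EReal) ≤ conformalQuantile α S x w}

/-- The `{0,1}`-valued function `(x, y) ↦ 𝟙{y ∈ C(x)}`. -/
def coverIndicator (C : 𝒳 → Set (Fin c)) : 𝒳 × Fin c → ℝ :=
  Set.indicator {z | z.2 ∈ C z.1} 1

/-- The coverage probability of a (realized) set-prediction rule `C` on a fresh test pair drawn
from `P`. -/
def coverage [MeasurableSpace 𝒳] (P : Measure (𝒳 × Fin c)) (C : 𝒳 → Set (Fin c)) : ℝ :=
  P.real {z | z.2 ∈ C z.1}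

/-- The label weights `w i y = 𝟙{y = Y i}` given by the labels of the calibration samples. -/
def trueWeights (zcal : Fin n → 𝒳 × Fin c) : Fin n × Fin c → ℝ :=
  fun p => if p.2 = (zcal p.1).2 then 1 else 0

/-- The feasible set of the weights: nonnegative, for each instance summing to one over the
labels, and satisfying `B w ≤ b`. -/
def feasibleSet (B : Matrix (Fin r) (Fin n × Fin c) ℝ) (b : Fin r → ℝ) :
    Set (Fin n × Fin c → ℝ) :=
  {w | 0 ≤ w ∧ (∀ i, ∑ y, w (i, y) = 1) ∧ B.mulVec w ≤ b}

end SplitConformal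

section Kernel

/-- The real-valued kernel `K : Z × Z → ℝ` of a reproducing kernel Hilbert space of real-valued
functions on `Z`. -/
def realKernel {Z : Type*} (H : Type*) [NormedAddCommGroup H] [InnerProductSpace ℝ H]
    [CompleteSpace H] [RKHS ℝ H Z ℝ] (z z' : Z) : ℝ :=
  RKHS.kernel H z z' 1

variable {𝒳 : Type*} {n m c r : ℕ}
variable (H : Type*) [NormedAddCommGroup H] [InnerProductSpace ℝ H]
  [RKHS ℝ H (𝒳 × Fin c) ℝ]

/-- The objective
`(n⁻² wᵀ K w - 2/(nm) vᵀ w + m⁻² 1ᵀ K̃ 1)^{1/2}` of the kernel quadratic program. -/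
def kernelObjective [CompleteSpace H] (x : Fin n → 𝒳) (ztr : Fin m → 𝒳 × Fin c)
    (w : Fin n × Fin c → ℝ) : ℝ :=
  let Kmat : Matrix (Fin n × Fin c) (Fin n × Fin c) ℝ :=
    Matrix.of fun p q => realKernel H (x p.1, p.2) (x q.1, q.2)
  let Ktr : Matrix (Fin m) (Fin m) ℝ := Matrix.of fun i j => realKernel H (ztr i) (ztr j)
  let v : Fin n × Fin c → ℝ := fun p => ∑ j, realKernel H (x p.1, p.2) (ztr j)
  √(1 / (n : ℝ) ^ 2 * (w ⬝ᵥ Kmat.mulVec w) - 2 / ((n : ℝ) * m) * (v ⬝ᵥ w)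
    + 1 / (m : ℝ) ^ 2 * ((1 : Fin m → ℝ) ⬝ᵥ Ktr.mulVec 1))

/-- `w` is an exact solution of the kernel quadratic program. -/
def IsKernelSolution [CompleteSpace H] (x : Fin n → 𝒳) (ztr : Fin m → 𝒳 × Fin c)
    (B : Matrix (Fin r) (Fin n × Fin c) ℝ) (b : Fin r → ℝ) (w : Fin n × Fin c → ℝ) : Prop :=
  w ∈ feasibleSet B b ∧ IsMinOn (kernelObjective H x ztr) (feasibleSet B b) w

variable {H}

/-- The approximation error `(1/n) ∑_{i,y} |𝔛_C(x i, y) - f(x i, y)|` of `f` at the calibration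
instances. -/
def approxError (x : Fin n → 𝒳) (C : 𝒳 → Set (Fin c)) (f : H) : ℝ :=
  1 / (n : ℝ) * ∑ p : Fin n × Fin c, |coverIndicator C (x p.1, p.2) - f (x p.1, p.2)|

variable (H)

/-- The bias term `D(𝔛_C, F_R)`: the infimum of the approximation error over the ball
`F_R = {f ∈ H : ‖f‖ ≤ R}`. -/
def ballBias (x : Fin n → 𝒳) (C : 𝒳 → Set (Fin c)) (R : ℝ) : ℝ :=
  ⨅ f : {f : H // ‖f‖ ≤ R}, approxError x C f.1

/-- The factor `2κ(1 + √(log(2/δ)))√(1/n + 1/m)` of the norm. -/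
def varianceFactor (n m : ℕ) (κ δ : ℝ) : ℝ :=
  2 * κ * (1 + √(Real.log (2 / δ))) * √(1 / (n : ℝ) + 1 / (m : ℝ))

/-- The excess gap `G^K_{n,m}`, the least value over `f ∈ H` of the approximation error plus
`varianceFactor n m κ δ * ‖f‖`. -/
def kernelGap (m : ℕ) (κ δ : ℝ) (x : Fin n → 𝒳) (C : 𝒳 → Set (Fin c)) : ℝ :=
  ⨅ f : H, (approxError x C f + varianceFactor n m κ δ * ‖f‖)

end Kernel

/-- The property `p` holds with probability at least `a`: some event of probability at least `a`
is contained in it. (For a measurable `p` this is `μ {ω | p ω} ≥ a`.) -/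
def HoldsWithProb {Ω : Type*} [MeasurableSpace Ω] (μ : Measure Ω) (a : ℝ) (p : Ω → Prop) : Prop :=
  ∃ A : Set Ω, MeasurableSet A ∧ ENNReal.ofReal a ≤ μ A ∧ ∀ ω ∈ A, p ω

end UnsupConformal

end

open MeasureTheory ProbabilityTheory
open scoped ENNReal

noncomputable section

namespace UnsupConformal

/-! By the choice of the quantile, the coverage computed on the calibration instances with the
fitted weights is at least `1 - α` (`one_sub_le_weightedCover`). For distinct scores it is at most
`1 - α + 2/(n+1)` once `α ≥ 2/(n+1)` (`weightedCover_le`); for smaller `α` the upper bound is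
trivial. Two comparisons carry this over to the true coverage.

Fitted to true labels: the objective of the program is the RKHS distance from the embedding of the
weighted instances to that of the training sample. True-label weights are feasible, so both
weightings lie within the true-label objective of the training embedding. Writing the cover
indicator as `f` plus a remainder bounds the change in coverage by the approximation error plus
twice that objective times `‖f‖` (`abs_weightedCover_sub_le`). This is deterministic and holds for
every rule and every `f`, so the data dependence of the rule costs nothing. The true-label objective
is the norm of a centered combination of features of `n + m` i.i.d. points, controlled by a second
moment and McDiarmid's inequality (`measure_lt_embeddingNorm_le`).

Empirical to true coverage: the threshold depends on the calibration data, so a bound uniform in the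
threshold is needed. The one-sided DKW inequality with Massart's constant
(`measure_exists_le_empFreq`), applied conditionally on the training sample, gives it. Each of the
two events costs `δ / 2`.

DKW is proved by a change of measure. Split the crossing event according to the largest crossing set
`A k`, and on that piece compare `P` with the tilt of `P` towards `A k`. One parameter `θ` makes
every likelihood ratio at least `exp (2nε²)` (`exists_tilt`). Since the pieces only involve the sets
containing `A k`, the tilts towards `A k` and towards the smallest set give them equal mass, so the
tilted masses sum to at most one. -/

/-! ### An optimal exponential tilt for empirical distribution functions -/

/-- Pinsker's inequality for two Bernoulli distributions. -/
lemma two_mul_sub_sq_le_klBernoulli {t q : ℝ} (ht : 0 < t) (htq : t ≤ q) (hq : q < 1) :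
    2 * (q - t) ^ 2 ≤ q * Real.log (q / t) + (1 - q) * Real.log ((1 - q) / (1 - t)) := by
  have hq0 : 0 < q := ht.trans_le htq
  -- Difference of the two sides as a function of the second parameter. It vanishes at `u = q`, and
  -- its derivative is `-(q - u)(1 - 2u)² / (u(1 - u)) ≤ 0`.
  let F : ℝ → ℝ := fun u => q * (Real.log q - Real.log u)
    + (1 - q) * (Real.log (1 - q) - Real.log (1 - u)) - 2 * (q - u) ^ 2
  have hder : ∀ u ∈ Set.Icc t q,
      HasDerivAt F (q * (-u⁻¹) + (1 - q) * (1 - u)⁻¹ + 4 * (q - u)) u := by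
    intro u hu
    have hu0 : 0 < u := ht.trans_le hu.1
    have hu1 : 0 < 1 - u := by linarith [hu.2]
    have h1 : HasDerivAt (fun u => q * (Real.log q - Real.log u)) (q * (-u⁻¹)) u :=
      ((Real.hasDerivAt_log hu0.ne').const_sub _).const_mul _
    have h2 : HasDerivAt (fun u => (1 - q) * (Real.log (1 - q) - Real.log (1 - u)))
        ((1 - q) * (1 - u)⁻¹) u := by
      have := ((((hasDerivAt_id u).const_sub 1).log hu1.ne').const_sub
        (Real.log (1 - q))).const_mul (1 - q)
      convert! this using 1
      simp [neg_div]
    have h3 : HasDerivAt (fun u => 2 * (q - u) ^ 2) (-4 * (q - u)) u := by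
      have := ((((hasDerivAt_id u).const_sub q).pow 2).const_mul 2)
      convert! this using 1
      simp; ring
    convert! (h1.add h2).sub h3 using 1
    ring
  have hanti : AntitoneOn F (Set.Icc t q) := by
    apply antitoneOn_of_deriv_nonpos (convex_Icc t q)
    · exact fun u hu => (hder u hu).continuousAt.continuousWithinAt
    · exact fun u hu =>
        (hder u (interior_subset hu)).differentiableAt.differentiableWithinAt
    · intro u hu
      have hu' := interior_subset hu
      have hu0 : 0 < u := ht.trans_le hu'.1
      have hu1 : 0 < 1 - u := by linarith [hu'.2]
      rw [(hder u hu').deriv]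
      have h : q * (-u⁻¹) + (1 - q) * (1 - u)⁻¹ + 4 * (q - u)
          = -((q - u) * (1 - 2 * u) ^ 2 / (u * (1 - u))) := by
        field_simp; ring
      rw [h]
      have : 0 ≤ q - u := by linarith [hu'.2]
      have := div_nonneg (mul_nonneg this (sq_nonneg (1 - 2 * u))) (mul_pos hu0 hu1).le
      linarith
  have h := hanti (Set.left_mem_Icc.2 htq) (Set.right_mem_Icc.2 htq) htq
  rw [Real.log_div hq0.ne' ht.ne', Real.log_div (by linarith) (by linarith)]
  simp only [F] at h
  linarith

/-- `x ↦ x / (exp x - 1)` lies above its tangents on the positive half-line. -/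
lemma tangent_le_div_exp_sub_one {a b : ℝ} (ha : 0 < a) (hb : 0 < b) :
    a / (Real.exp a - 1) + (Real.exp a - 1 - a * Real.exp a) / (Real.exp a - 1) ^ 2 * (b - a)
      ≤ b / (Real.exp b - 1) := by
  have hpos : ∀ x : ℝ, 0 < x → 0 < Real.exp x - 1 := fun x hx => by
    linarith [Real.add_one_lt_exp hx.ne']
  let ψ : ℝ → ℝ := fun x => x / (Real.exp x - 1)
  let ψ' : ℝ → ℝ := fun x => (Real.exp x - 1 - x * Real.exp x) / (Real.exp x - 1) ^ 2
  have h1 : ∀ x, 0 < x → HasDerivAt ψ (ψ' x) x := fun x hx => by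
    have := (hasDerivAt_id x).div ((Real.hasDerivAt_exp x).sub_const 1) (hpos x hx).ne'
    convert! this using 1
    simp [ψ']
  have h2 : ∀ x, 0 < x → HasDerivAt ψ' (Real.exp x * ((x - 2) * Real.exp x + x + 2)
      / (Real.exp x - 1) ^ 3) x := fun x hx => by
    have hx' := (hpos x hx).ne'
    have hnum : HasDerivAt (fun x => Real.exp x - 1 - x * Real.exp x) (-(x * Real.exp x)) x := by
      have := ((Real.hasDerivAt_exp x).sub_const 1).sub
        ((hasDerivAt_id x).mul (Real.hasDerivAt_exp x))
      convert! this using 1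
      simp
    have := hnum.div (((Real.hasDerivAt_exp x).sub_const 1).pow 2) (pow_ne_zero 2 hx')
    convert! this using 1
    field_simp
    simp
    ring
  -- The sign of the second derivative: this factor vanishes at `0` and has nonnegative derivative
  -- because `exp (-x) ≥ 1 - x`.
  have h3 : ∀ x : ℝ, 0 ≤ x → 0 ≤ (x - 2) * Real.exp x + x + 2 := by
    have hd : ∀ x : ℝ, HasDerivAt (fun x => (x - 2) * Real.exp x + x + 2)
        ((x - 1) * Real.exp x + 1) x := fun x => by
      have := ((((hasDerivAt_id x).sub_const 2).mul (Real.hasDerivAt_exp x)).add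
        (hasDerivAt_id x)).add_const 2
      convert! this using 1
      simp; ring
    have hmono : MonotoneOn (fun x : ℝ => (x - 2) * Real.exp x + x + 2) (Set.Ici 0) := by
      apply monotoneOn_of_deriv_nonneg (convex_Ici 0)
      · exact fun u _ => (hd u).continuousAt.continuousWithinAt
      · exact fun u _ => (hd u).differentiableAt.differentiableWithinAt
      · intro u _
        rw [(hd u).deriv]
        have e1 : -u + 1 ≤ Real.exp (-u) := Real.add_one_le_exp _
        have e2 := mul_le_mul_of_nonneg_right e1 (Real.exp_pos u).le
        rw [← Real.exp_add] at e2
        simp at e2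
        linarith
    intro x hx
    have := hmono Set.self_mem_Ici hx hx
    simpa using this
  have hconv : ConvexOn ℝ (Set.Ioi 0) ψ := by
    apply convexOn_of_hasDerivWithinAt2_nonneg (f' := ψ')
      (f'' := fun x => Real.exp x * ((x - 2) * Real.exp x + x + 2) / (Real.exp x - 1) ^ 3)
      (convex_Ioi 0)
    · exact fun x hx => (h1 x hx).continuousAt.continuousWithinAt
    · exact fun x hx => (h1 x (interior_subset hx)).hasDerivWithinAt
    · exact fun x hx => (h2 x (interior_subset hx)).hasDerivWithinAt
    · intro x hx
      have hx' : 0 < x := interior_subset hx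
      have := h3 x hx'.le
      have := hpos x hx'
      positivity
  rcases lt_trichotomy a b with hab | hab | hab
  · have := hconv.le_slope_of_hasDerivAt (Set.mem_Ioi.2 ha) (Set.mem_Ioi.2 hb) hab (h1 a ha)
    rw [slope_def_field, le_div_iff₀ (by linarith)] at this
    simp only [ψ, ψ'] at this
    linarith
  · subst hab; simp
  · have := hconv.slope_le_of_hasDerivAt (Set.mem_Ioi.2 hb) (Set.mem_Ioi.2 ha) hab (h1 a ha)
    rw [slope_def_field, div_le_iff₀ (by linarith)] at this
    simp only [ψ, ψ'] at this
    linarith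

/-- The expression runs continuously from `0` (as `a → 0`) to `1` (as `a → ∞`), as its factorization
`hE` shows. The equation is the stationarity condition for the minimization in `exists_tilt`. -/
lemma exists_tilt_parameter {ε : ℝ} (h0 : 0 < ε) (h1 : ε < 1) :
    ∃ a : ℝ, 0 < a ∧ (Real.exp a - 1 - a) * (a * Real.exp a - Real.exp a + 1)
      / (a * (Real.exp a - 1) ^ 2) = ε := by
  have hpos : ∀ x : ℝ, 0 < x → 0 < Real.exp x - 1 := fun x hx => by
    linarith [Real.add_one_lt_exp hx.ne']
  let E : ℝ → ℝ := fun a => (Real.exp a - 1 - a) * (a * Real.exp a - Real.exp a + 1)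
    / (a * (Real.exp a - 1) ^ 2)
  have hE : ∀ a, 0 < a → E a = (1 - a / (Real.exp a - 1))
      * (1 - (1 / a - 1 / (Real.exp a - 1))) := fun a ha => by
    have := (hpos a ha).ne'
    simp only [E]
    field_simp
    ring
  have hlow : E ε ≤ ε := by
    rw [hE ε h0]
    have hx := hpos ε h0
    have hxe : ε ≤ Real.exp ε - 1 := by linarith [Real.add_one_le_exp ε]
    have hq : Real.exp ε - 1 - ε ≤ ε ^ 2 := by
      have := Real.abs_exp_sub_one_sub_id_le (x := ε) (by rw [abs_of_pos h0]; exact h1.le)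
      exact (le_abs_self _).trans this
    have h2 : 1 - ε / (Real.exp ε - 1) ≤ ε := by
      rw [sub_le_iff_le_add, ← sub_le_iff_le_add', le_div_iff₀ hx]
      nlinarith
    have h3 : 0 ≤ 1 - ε / (Real.exp ε - 1) := by
      rw [sub_nonneg, div_le_one hx]; exact hxe
    have h4 : 1 / (Real.exp ε - 1) ≤ 1 / ε := one_div_le_one_div_of_le h0 hxe
    nlinarith
  -- From `exp a ≥ 1 + a + a²/2` one gets `E a ≥ (1 - 2/(2+a))(1 - 1/a) = 1 - 3/(a+2)`, which
  -- dictates the endpoint `3 / (1 - ε)`.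
  have hhigh : ε ≤ E (3 / (1 - ε)) := by
    set a := 3 / (1 - ε) with ha
    have ha3 : a * (1 - ε) = 3 := by rw [ha]; field_simp [(by linarith : (1 - ε) ≠ 0)]
    have ha0 : 3 ≤ a := by rw [ha, le_div_iff₀ (by linarith)]; linarith
    have hap : 0 < a := by linarith
    rw [hE a hap]
    have hx := hpos a hap
    have hq := Real.quadratic_le_exp_of_nonneg hap.le
    have h2 : a / (Real.exp a - 1) ≤ 2 / (2 + a) := by
      rw [div_le_div_iff₀ hx (by linarith)]
      nlinarith
    have h3 : 0 < 1 / (Real.exp a - 1) := by positivity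
    have h4 : 1 / a ≤ 1 := by rw [div_le_one hap]; linarith
    calc ε = 1 - 3 / a := by field_simp; linarith
      _ ≤ (1 - 2 / (2 + a)) * (1 - 1 / a) := by
        have : (1 - 2 / (2 + a)) * (1 - 1 / a) = 1 - 3 / (a + 2) := by field_simp; ring
        rw [this]
        have := div_le_div_of_nonneg_left (by norm_num : (0 : ℝ) ≤ 3) hap
          (by linarith : a ≤ a + 2)
        linarith
      _ ≤ _ := by
        apply mul_le_mul <;> try linarith
        have : 2 / (2 + a) ≤ 1 := by rw [div_le_one (by linarith)]; linarith
        linarith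
  have hle : ε ≤ 3 / (1 - ε) := by
    rw [le_div_iff₀ (by linarith)]; nlinarith
  have hcont : ContinuousOn E (Set.Icc ε (3 / (1 - ε))) := by
    intro x hx
    have hx0 : 0 < x := h0.trans_le hx.1
    have := hpos x hx0
    apply ContinuousAt.continuousWithinAt
    apply ContinuousAt.div (by fun_prop) (by fun_prop)
    positivity
  obtain ⟨a, ha, hae⟩ := intermediate_value_Icc hle hcont ⟨hlow, hhigh⟩
  exact ⟨a, h0.trans_le ha.1, hae⟩

/-- A single tilt parameter works simultaneously for all success probabilities `t`. -/
lemma exists_tilt {ε : ℝ} (h0 : 0 < ε) (h1 : ε < 1) :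
    ∃ θ : ℝ, 0 < θ ∧ ∀ t : ℝ, 0 < t →
      2 * ε ^ 2 + Real.log (1 + θ) ≤ (t + ε) * Real.log (1 + θ / t) := by
  obtain ⟨a, ha, hae⟩ := exists_tilt_parameter h0 h1
  have hxa : 0 < Real.exp a - 1 - a := by linarith [Real.add_one_lt_exp ha.ne']
  have hx : 0 < Real.exp a - 1 := by linarith
  have hy : 0 < a * Real.exp a - Real.exp a + 1 := by
    have e1 : -a + 1 < Real.exp (-a) := Real.add_one_lt_exp (by linarith)
    have e2 := mul_lt_mul_of_pos_right e1 (Real.exp_pos a)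
    rw [← Real.exp_add] at e2
    simp at e2
    linarith
  -- With `b = log (1 + θ/t)` the right-hand side becomes `θ b / (exp b - 1) + ε b`, convex in `b`.
  -- The choice of `a` and `θ` puts its minimum at `b = a`. At the corresponding `t₀`, subtracting
  -- `log (1 + θ)` leaves exactly the Bernoulli divergence of `t₀ + ε` from `t₀`, so Pinsker's
  -- inequality finishes.
  set θ := (Real.exp a - 1 - a) / a with hθ
  have hθ0 : 0 < θ := div_pos hxa ha
  set t₀ := θ / (Real.exp a - 1) with ht₀
  have ht₀0 : 0 < t₀ := div_pos hθ0 hx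
  have hkl : 2 * ε ^ 2 + Real.log (1 + θ) ≤ (t₀ + ε) * a := by
    have hq1 : 1 - (t₀ + ε) = (a * Real.exp a - Real.exp a + 1) / (Real.exp a - 1) ^ 2 := by
      rw [← hae, ht₀, hθ]; field_simp; ring
    have hq : t₀ + ε < 1 := by
      have := div_pos hy (pow_pos hx 2)
      linarith
    have hr2 : (1 - (t₀ + ε)) / (1 - t₀) = (1 + θ)⁻¹ := by
      have h : 1 - t₀ = (a * Real.exp a - Real.exp a + 1) / (a * (Real.exp a - 1)) := by
        rw [ht₀, hθ]; field_simp; ring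
      have h' : 1 + θ = (Real.exp a - 1) / a := by rw [hθ]; field_simp; ring
      rw [hq1, h, h', inv_div]
      generalize a * Real.exp a - Real.exp a + 1 = y at hy
      field_simp
    have hr1 : (t₀ + ε) / t₀ = Real.exp a * (1 + θ)⁻¹ := by
      have h : t₀ + ε = (Real.exp a - 1 - a) * Real.exp a / (Real.exp a - 1) ^ 2 := by
        rw [← hae, ht₀, hθ]; field_simp; ring
      rw [h, ht₀, hθ]; field_simp; ring
    have h := two_mul_sub_sq_le_klBernoulli ht₀0 (by linarith : t₀ ≤ t₀ + ε) hq
    rw [hr1, hr2, Real.log_mul (Real.exp_pos a).ne' (by positivity), Real.log_exp,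
      Real.log_inv] at h
    have e : t₀ + ε - t₀ = ε := by ring
    rw [e] at h
    linarith
  refine ⟨θ, hθ0, fun t ht => hkl.trans ?_⟩
  have hb : 0 < Real.log (1 + θ / t) := Real.log_pos (by linarith [div_pos hθ0 ht])
  set b := Real.log (1 + θ / t) with hbdef
  have heb : Real.exp b - 1 = θ / t := by
    rw [hbdef, Real.exp_log (by positivity)]; ring
  have h := mul_le_mul_of_nonneg_left (tangent_le_div_exp_sub_one ha hb) hθ0.le
  have e1 : θ * (b / (Real.exp b - 1)) = t * b := by rw [heb]; field_simp
  have e2 : θ * (a / (Real.exp a - 1) + (Real.exp a - 1 - a * Real.exp a)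
      / (Real.exp a - 1) ^ 2 * (b - a)) = t₀ * a - ε * (b - a) := by
    rw [← hae, ht₀, hθ]; field_simp; ring
  rw [e1, e2] at h
  linarith

/-! ### The one-sided Dvoretzky–Kiefer–Wolfowitz–Massart inequality -/

/-- The proportion of the sample `x` that lies in `A`. -/
def empFreq {E : Type*} {n : ℕ} (x : Fin n → E) (A : Set E) : ℝ :=
  1 / (n : ℝ) * ∑ i, A.indicator (1 : E → ℝ) (x i)

lemma measurable_empFreq {E : Type*} [MeasurableSpace E] {n : ℕ} {A : Set E}
    (hA : MeasurableSet A) : Measurable fun x : Fin n → E => empFreq x A := by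
  refine Measurable.const_mul (Finset.measurable_sum _ fun i _ => ?_) _
  exact (measurable_one.indicator hA).comp (measurable_pi_apply i)

lemma empFreq_le_one {E : Type*} {n : ℕ} (hn : 0 < n) (x : Fin n → E) (A : Set E) :
    empFreq x A ≤ 1 := by
  have h : ∑ i, A.indicator (1 : E → ℝ) (x i) ≤ ∑ _i : Fin n, (1 : ℝ) :=
    Finset.sum_le_sum fun i _ => Set.indicator_le_self' (fun _ _ => zero_le_one) (x i)
  rw [Finset.sum_const, Finset.card_univ, Fintype.card_fin, nsmul_eq_mul, mul_one] at h
  have hn' : (0 : ℝ) < n := by exact_mod_cast hn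
  rw [empFreq, one_div, inv_mul_le_iff₀ hn', mul_one]
  exact h

/-- A finite product of measures with densities has the product density. -/
lemma pi_withDensity {ι E : Type*} [Fintype ι] [MeasurableSpace E] (P : Measure E)
    [IsProbabilityMeasure P] {f : E → ℝ≥0∞} (hf : Measurable f)
    [IsProbabilityMeasure (P.withDensity f)] :
    (Measure.pi fun _ : ι => P.withDensity f)
      = (Measure.pi fun _ : ι => P).withDensity fun x => ∏ i, f (x i) := by
  refine Measure.pi_eq fun s hs => ?_
  rw [withDensity_apply _ (MeasurableSet.univ_pi hs), ← lintegral_indicator (.univ_pi hs)]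
  have h : ∀ x : ι → E, (Set.univ.pi s).indicator (fun x => ∏ i, f (x i)) x
      = ∏ i, (s i).indicator f (x i) := by
    intro x
    by_cases hx : x ∈ Set.univ.pi s
    · rw [Set.indicator_of_mem hx]
      exact Finset.prod_congr rfl fun i _ => (Set.indicator_of_mem (hx i trivial) f).symm
    · rw [Set.indicator_of_notMem hx]
      simp only [Set.mem_univ_pi, not_forall] at hx
      obtain ⟨i, hi⟩ := hx
      exact (Finset.prod_eq_zero (Finset.mem_univ i) (Set.indicator_of_notMem hi f)).symm
  simp_rw [h]
  have hind : iIndepFun (fun i (x : ι → E) => (s i).indicator f (x i))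
      (Measure.pi fun _ : ι => P) :=
    iIndepFun_pi (X := fun i => (s i).indicator f) fun i => (hf.indicator (hs i)).aemeasurable
  rw [lintegral_prod_eq_prod_lintegral_of_indepFun _ _ hind fun i =>
    (hf.indicator (hs i)).comp (measurable_pi_apply i)]
  refine Finset.prod_congr rfl fun i _ => ?_
  rw [(measurePreserving_eval (fun _ : ι => P) i).lintegral_comp (hf.indicator (hs i)),
    lintegral_indicator (hs i), withDensity_apply _ (hs i)]

/-- The density, with respect to `P`, of the mixture of `P` and of `P` conditioned on `A` with
weights proportional to `1` and `θ`. -/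
def tiltDensity {E : Type*} [MeasurableSpace E] (P : Measure E) (θ : ℝ) (A : Set E) (x : E) : ℝ :=
  (1 + θ)⁻¹ * (1 + θ / P.real A * A.indicator 1 x)

section Tilt

variable {E : Type*} [MeasurableSpace E] {P : Measure E} {θ : ℝ} {A : Set E}

lemma measurable_tiltDensity (hA : MeasurableSet A) : Measurable (tiltDensity P θ A) :=
  (((measurable_one.indicator hA).const_mul _).const_add _).const_mul _

lemma tiltDensity_nonneg (hθ : 0 ≤ θ) (x : E) : 0 ≤ tiltDensity P θ A x := by
  have : (0 : ℝ) ≤ A.indicator 1 x := Set.indicator_nonneg (fun _ _ => zero_le_one) _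
  have := div_nonneg hθ (measureReal_nonneg (μ := P) (s := A))
  unfold tiltDensity
  positivity

lemma withDensity_tiltDensity_apply [IsProbabilityMeasure P] (hθ : 0 ≤ θ)
    (hA : MeasurableSet A) {V : Set E} (hV : MeasurableSet V) :
    P.withDensity (fun x => ENNReal.ofReal (tiltDensity P θ A x)) V
      = ENNReal.ofReal ((1 + θ)⁻¹ * (P.real V + θ / P.real A * P.real (A ∩ V))) := by
  have hi : Integrable (fun x => θ / P.real A * A.indicator (1 : E → ℝ) x) (P.restrict V) :=
    ((integrable_const (1 : ℝ)).indicator hA).const_mul _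
  have hi' : Integrable (tiltDensity P θ A) (P.restrict V) :=
    ((integrable_const 1).add hi).const_mul _
  rw [withDensity_apply _ hV, ← ofReal_integral_eq_lintegral_ofReal hi'
    (.of_forall fun x => tiltDensity_nonneg hθ x)]
  congr 1
  unfold tiltDensity
  rw [integral_const_mul, integral_add (integrable_const _) hi, integral_const_mul,
    integral_indicator_one hA, measureReal_restrict_apply hA]
  simp

lemma isProbabilityMeasure_tilt [IsProbabilityMeasure P] (hθ : 0 ≤ θ)
    (hA : MeasurableSet A) (hA0 : 0 < P.real A) :
    IsProbabilityMeasure (P.withDensity fun x => ENNReal.ofReal (tiltDensity P θ A x)) := by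
  constructor
  rw [withDensity_tiltDensity_apply hθ hA .univ]
  have : (1 + θ)⁻¹ * (P.real Set.univ + θ / P.real A * P.real (A ∩ Set.univ)) = 1 := by
    rw [Set.inter_univ]; simp; field_simp
  rw [this, ENNReal.ofReal_one]

lemma prod_tiltDensity {n : ℕ} (hn : 0 < n) (x : Fin n → E) :
    ∏ i, tiltDensity P θ A (x i)
      = (1 + θ)⁻¹ ^ n * (1 + θ / P.real A) ^ ((n : ℝ) * empFreq x A) := by
  classical
  have hn' : (n : ℝ) ≠ 0 := by exact_mod_cast hn.ne'
  have h : ∀ i, tiltDensity P θ A (x i)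
      = (1 + θ)⁻¹ * if x i ∈ A then 1 + θ / P.real A else 1 := by
    intro i
    by_cases hi : x i ∈ A <;> simp [tiltDensity, hi]
  simp_rw [h]
  rw [Finset.prod_mul_distrib, Finset.prod_const, Finset.card_univ, Fintype.card_fin,
    Finset.prod_ite, Finset.prod_const_one, mul_one, Finset.prod_const]
  congr 1
  rw [empFreq, ← mul_assoc, mul_one_div_cancel hn', one_mul]
  simp [Set.indicator_apply]

end Tilt

/-- The one-sided Dvoretzky–Kiefer–Wolfowitz–Massart inequality for a finite chain of sets of
positive probability. -/
lemma measure_exists_le_empFreq_of_pos {E ι : Type*} [MeasurableSpace E] [Fintype ι]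
    [LinearOrder ι] (P : Measure E) [IsProbabilityMeasure P] {A : ι → Set E} (hA : Monotone A)
    (hAm : ∀ k, MeasurableSet (A k)) (hA0 : ∀ k, 0 < P.real (A k)) {n : ℕ} (hn : 0 < n)
    {ε : ℝ} (h0 : 0 < ε) (h1 : ε < 1) :
    (Measure.pi fun _ : Fin n => P) {x | ∃ k, P.real (A k) + ε ≤ empFreq x (A k)}
      ≤ ENNReal.ofReal (Real.exp (-(2 * n * ε ^ 2))) := by
  classical
  obtain ⟨θ, hθ, htilt⟩ := exists_tilt h0 h1
  rcases isEmpty_or_nonempty ι with hι | hι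
  · simp
  set f : ι → E → ℝ≥0∞ := fun k x => ENNReal.ofReal (tiltDensity P θ (A k) x) with hf
  have hfm : ∀ k, Measurable (f k) := fun k => (measurable_tiltDensity (hAm k)).ennreal_ofReal
  have hprob : ∀ k, IsProbabilityMeasure (P.withDensity (f k)) := fun k =>
    isProbabilityMeasure_tilt hθ.le (hAm k) (hA0 k)
  set D : ι → Set (Fin n → E) := fun k => {x | P.real (A k) + ε ≤ empFreq x (A k)} with hD
  have hDm : ∀ k, MeasurableSet (D k) := fun k =>
    measurableSet_le measurable_const (measurable_empFreq (hAm k))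
  -- `F k`: `k` is the largest crossing index. Splitting from the top makes `F k` depend only on the
  -- sets containing `A k`.
  set F : ι → Set (Fin n → E) := fun k => D k \ ⋃ j ∈ Set.Ioi k, D j with hF
  have hFm : ∀ k, MeasurableSet (F k) := fun k =>
    (hDm k).diff (.biUnion (Set.to_countable _) fun j _ => hDm j)
  have hFdisj : Pairwise (Function.onFun Disjoint F) := by
    have key : ∀ j k, j < k → Disjoint (F j) (F k) := fun j k hjk =>
      Set.disjoint_left.2 fun x hj hk =>
        hj.2 (Set.mem_biUnion (show k ∈ Set.Ioi j from hjk) hk.1)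
    intro j k hjk
    rcases lt_or_gt_of_ne hjk with h | h
    · exact key j k h
    · exact (key k j h).symm
  have hunion : {x | ∃ k, P.real (A k) + ε ≤ empFreq x (A k)} ⊆ ⋃ k, F k := by
    intro x ⟨k, hk⟩
    obtain ⟨l, hl, hmax⟩ := (Finset.univ.filter fun k => x ∈ D k).exists_max_image id
      ⟨k, by simpa [hD] using hk⟩
    refine Set.mem_iUnion.2 ⟨l, (Finset.mem_filter.1 hl).2, ?_⟩
    simp only [Set.mem_iUnion, not_exists]
    intro j hj hjD
    exact absurd (hmax j (by simpa using hjD)) (not_le.2 hj)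
  -- on the event that `k` is the last crossing, the likelihood ratio is large
  have hlarge : ∀ k, ENNReal.ofReal (Real.exp (2 * n * ε ^ 2)) * (Measure.pi fun _ => P) (F k)
      ≤ (Measure.pi fun _ : Fin n => P.withDensity (f k)) (F k) := by
    intro k
    rw [pi_withDensity P (hfm k), withDensity_apply _ (hFm k), ← setLIntegral_const]
    refine setLIntegral_mono' (hFm k) fun x hx => ?_
    rw [← ENNReal.ofReal_prod_of_nonneg fun i _ => tiltDensity_nonneg hθ.le (x i)]
    refine ENNReal.ofReal_le_ofReal ?_
    rw [prod_tiltDensity hn]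
    have hx1 : P.real (A k) + ε ≤ empFreq x (A k) := hx.1
    have hb : 1 ≤ 1 + θ / P.real (A k) := by linarith [div_pos hθ (hA0 k)]
    have hn' : (0 : ℝ) ≤ n := by positivity
    calc Real.exp (2 * n * ε ^ 2)
        ≤ Real.exp (n * ((P.real (A k) + ε) * Real.log (1 + θ / P.real (A k))
            - Real.log (1 + θ))) := by
          refine Real.exp_le_exp.2 ?_
          have := mul_le_mul_of_nonneg_left (htilt _ (hA0 k)) hn'
          linarith
      _ = (1 + θ)⁻¹ ^ n * (1 + θ / P.real (A k)) ^ ((n : ℝ) * (P.real (A k) + ε)) := by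
          rw [mul_sub, Real.exp_sub, Real.rpow_def_of_pos (by linarith), inv_pow,
            Real.exp_nat_mul (Real.log (1 + θ)), Real.exp_log (by linarith), div_eq_inv_mul]
          ring_nf
      _ ≤ _ := by
          gcongr
  -- the tilted laws agree on events that only depend on the larger sets
  set kmin : ι := Finset.univ.min' Finset.univ_nonempty with hkmin
  have hmin : ∀ k, kmin ≤ k := fun k => Finset.min'_le _ _ (Finset.mem_univ k)
  have hagree : ∀ k, (Measure.pi fun _ : Fin n => P.withDensity (f k)) (F k)
      = (Measure.pi fun _ : Fin n => P.withDensity (f kmin)) (F k) := by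
    intro k
    -- `τ x` records which sets `A j` with `j ≥ k` contain `x`; the event `F k` is a function of
    -- these types alone.
    let τ : E → ι → Prop := fun x j => k ≤ j ∧ x ∈ A j
    have hτ : Measurable τ := by
      refine measurable_pi_iff.2 fun j => ?_
      refine measurableSet_setOfPred.1 ?_
      exact (MeasurableSet.const _).inter (hAm j)
    let U : ι → Set (Fin n → ι → Prop) := fun j =>
      {p | P.real (A j) + ε ≤ 1 / (n : ℝ) * ∑ i, if p i j then (1 : ℝ) else 0}
    have hU : ∀ j, k ≤ j → D j = (fun x i => τ (x i)) ⁻¹' U j := by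
      intro j hj
      ext x
      simp [D, U, τ, hj, empFreq, Set.indicator_apply]
    have hFU : F k = (fun x i => τ (x i)) ⁻¹' (U k \ ⋃ j ∈ Set.Ioi k, U j) := by
      rw [Set.preimage_sdiff, Set.preimage_iUnion₂, hF]
      simp only
      rw [hU k le_rfl]
      congr 1
      exact Set.iUnion₂_congr fun j hj => hU j (le_of_lt hj)
    have hτ' : Measurable fun (x : Fin n → E) i => τ (x i) :=
      measurable_pi_iff.2 fun i => hτ.comp (measurable_pi_apply i)
    have hmap : (P.withDensity (f k)).map τ = (P.withDensity (f kmin)).map τ := by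
      ext V hV
      rw [Measure.map_apply hτ hV, Measure.map_apply hτ hV,
        withDensity_tiltDensity_apply hθ.le (hAm _) (hτ hV),
        withDensity_tiltDensity_apply hθ.le (hAm _) (hτ hV)]
      -- Up to normalization, both tilts add to `P` a mass `θ` inside `A k`, where `τ` is constant;
      -- hence their images under `τ` coincide.
      have hconst : ∀ x ∈ A k, τ x = fun j => k ≤ j := by
        intro x hx
        funext j
        exact propext ⟨fun h => h.1, fun h => ⟨h, hA h hx⟩⟩
      have hsub : A kmin ⊆ A k := hA (hmin k)
      by_cases hc : (fun j => k ≤ j) ∈ V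
      · have h1 : A k ⊆ τ ⁻¹' V := fun x hx => by
          rw [Set.mem_preimage, hconst x hx]; exact hc
        rw [Set.inter_eq_left.2 h1, Set.inter_eq_left.2 (hsub.trans h1),
          div_mul_cancel₀ _ (hA0 _).ne', div_mul_cancel₀ _ (hA0 _).ne']
      · have h1 : A k ∩ τ ⁻¹' V = ∅ := by
          ext x
          simp only [Set.mem_inter_iff, Set.mem_preimage, Set.mem_empty_iff_false, iff_false,
            not_and]
          intro hx
          rw [hconst x hx]; exact hc
        have h2 : A kmin ∩ τ ⁻¹' V = ∅ :=
          Set.subset_empty_iff.1 (h1 ▸ Set.inter_subset_inter_left _ hsub)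
        rw [h1, h2]
        simp
    have hmeas : MeasurableSet (U k \ ⋃ j ∈ Set.Ioi k, U j) := .of_discrete
    have : ∀ l, IsProbabilityMeasure ((P.withDensity (f l)).map τ) := fun l =>
      Measure.isProbabilityMeasure_map hτ.aemeasurable
    rw [hFU, ← Measure.map_apply hτ' hmeas, ← Measure.map_apply hτ' hmeas,
      Measure.pi_map_pi (fun _ => hτ.aemeasurable), Measure.pi_map_pi (fun _ => hτ.aemeasurable),
      hmap]
  have htotal : ENNReal.ofReal (Real.exp (2 * n * ε ^ 2)) * (Measure.pi fun _ : Fin n => P)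
      {x | ∃ k, P.real (A k) + ε ≤ empFreq x (A k)} ≤ 1 := by
    calc _ ≤ ENNReal.ofReal (Real.exp (2 * n * ε ^ 2)) * (Measure.pi fun _ : Fin n => P)
          (⋃ k, F k) := by gcongr
      _ = ∑ k, ENNReal.ofReal (Real.exp (2 * n * ε ^ 2)) * (Measure.pi fun _ : Fin n => P)
          (F k) := by
        rw [measure_iUnion hFdisj hFm, tsum_fintype, Finset.mul_sum]
      _ ≤ ∑ k, (Measure.pi fun _ : Fin n => P.withDensity (f kmin)) (F k) :=
        Finset.sum_le_sum fun k _ => (hlarge k).trans (hagree k).le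
      _ = (Measure.pi fun _ : Fin n => P.withDensity (f kmin)) (⋃ k, F k) := by
        rw [measure_iUnion hFdisj hFm, tsum_fintype]
      _ ≤ 1 := prob_le_one
  rw [Real.exp_neg, ENNReal.ofReal_inv_of_pos (Real.exp_pos _), ← one_div,
    ENNReal.le_div_iff_mul_le (Or.inl (by simp [Real.exp_pos])) (Or.inl ENNReal.ofReal_ne_top),
    mul_comm]
  exact htotal

/-- The one-sided Dvoretzky–Kiefer–Wolfowitz–Massart inequality, with the optimal constant, for a
countable chain of sets. -/
theorem measure_exists_le_empFreq {E ι : Type*} [MeasurableSpace E] [Countable ι]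
    [LinearOrder ι] (P : Measure E) [IsProbabilityMeasure P] {A : ι → Set E} (hA : Monotone A)
    (hAm : ∀ k, MeasurableSet (A k)) {n : ℕ} (hn : 0 < n) {ε : ℝ} (h0 : 0 < ε) :
    (Measure.pi fun _ : Fin n => P) {x | ∃ k, P.real (A k) + ε ≤ empFreq x (A k)}
      ≤ ENNReal.ofReal (Real.exp (-(2 * n * ε ^ 2))) := by
  classical
  -- The tilt divides by `P (A k)`, so null sets are treated apart: almost surely no sample point
  -- falls in any of the countably many.
  have hnull : (Measure.pi fun _ : Fin n => P)
      {x | ∃ k, P.real (A k) = 0 ∧ ∃ i, x i ∈ A k} = 0 := by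
    have : {x : Fin n → E | ∃ k, P.real (A k) = 0 ∧ ∃ i, x i ∈ A k}
        = ⋃ k : {k // P.real (A k) = 0}, ⋃ i, Function.eval i ⁻¹' A k := by
      ext x; simp
    rw [this, measure_iUnion_null_iff]
    intro k
    rw [measure_iUnion_null_iff]
    intro i
    exact Measure.pi_eval_preimage_null _ ((measureReal_eq_zero_iff).1 k.2)
  -- A deviation of size at least one forces `P (A k) = 0` together with a sample point in `A k`.
  rcases le_or_gt 1 ε with h1 | h1
  · refine le_of_eq_of_le (measure_mono_null ?_ hnull) zero_le
    intro x ⟨k, hk⟩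
    have hle := empFreq_le_one hn x (A k)
    have hnn : 0 ≤ P.real (A k) := measureReal_nonneg
    refine ⟨k, by linarith, ?_⟩
    by_contra! hx
    have : empFreq x (A k) = 0 := by simp [empFreq, hx]
    linarith
  let I := {k // 0 < P.real (A k)}
  let D : I → Set (Fin n → E) := fun k => {x | P.real (A k) + ε ≤ empFreq x (A k)}
  have hsub : {x | ∃ k, P.real (A k) + ε ≤ empFreq x (A k)}
      ⊆ {x | ∃ k, P.real (A k) = 0 ∧ ∃ i, x i ∈ A k} ∪ ⋃ s : Finset I, ⋃ k ∈ s, D k := by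
    intro x ⟨k, hk⟩
    rcases (measureReal_nonneg (μ := P) (s := A k)).eq_or_lt with hk0 | hk0
    · refine Or.inl ⟨k, hk0.symm, ?_⟩
      by_contra! hx
      have : empFreq x (A k) = 0 := by simp [empFreq, hx]
      linarith
    · refine Or.inr (Set.mem_iUnion.2 ⟨{⟨k, hk0⟩}, ?_⟩)
      simpa [D] using hk
  refine (measure_mono hsub).trans ((measure_union_le _ _).trans ?_)
  -- Finite subchains exhaust the countable chain, with a bound free of their size, so continuity
  -- from below applies.
  rw [hnull, zero_add, Directed.measure_iUnion]
  · refine iSup_le fun s => ?_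
    have := measure_exists_le_empFreq_of_pos (ι := s) P (A := fun k => A k.1.1)
      (fun j k hjk => hA hjk) (fun k => hAm _) (fun k => k.1.2) hn h0 h1
    refine le_of_eq_of_le ?_ this
    congr 1
    ext x
    simp [D]
  · exact directed_of_isDirected_le fun s t hst =>
      Set.biUnion_subset_biUnion_left (by exact_mod_cast hst)

/-! ### McDiarmid's inequality -/

lemma integrable_of_abs_le {E : Type*} [MeasurableSpace E] {P : Measure E} [IsFiniteMeasure P]
    {f : E → ℝ} (hf : Measurable f) {C : ℝ} (hC : ∀ x, |f x| ≤ C) : Integrable f P :=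
  Integrable.of_bound hf.aestronglyMeasurable C (.of_forall fun x => by simpa using hC x)

lemma abs_integral_le_of_abs_le {E : Type*} [MeasurableSpace E] {P : Measure E}
    [IsProbabilityMeasure P] {f : E → ℝ} {C : ℝ} (hC : ∀ x, |f x| ≤ C) : |∫ x, f x ∂P| ≤ C := by
  have := norm_integral_le_of_norm_le_const (μ := P) (f := f) (C := C)
    (.of_forall fun x => by simpa using hC x)
  simpa using this

/-- Hoeffding's lemma for a bounded function whose values differ by at most `c`. -/
lemma integral_exp_mul_sub_integral_le {E : Type*} [MeasurableSpace E] (P : Measure E)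
    [IsProbabilityMeasure P] {f : E → ℝ} (hf : Measurable f) {C c : ℝ} (hC : ∀ x, |f x| ≤ C)
    (hc : ∀ x y, f x - f y ≤ c) (s : ℝ) :
    ∫ x, Real.exp (s * (f x - ∫ y, f y ∂P)) ∂P ≤ Real.exp (s ^ 2 * c ^ 2 / 8) := by
  have hne : Nonempty E := nonempty_of_isProbabilityMeasure P
  have hbdd : BddBelow (Set.range f) := ⟨-C, by
    rintro _ ⟨x, rfl⟩; exact (abs_le.1 (hC x)).1⟩
  have hmem : ∀ x, f x ∈ Set.Icc (⨅ y, f y) ((⨅ y, f y) + c) := fun x =>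
    ⟨ciInf_le hbdd x, by
      have : f x - c ≤ ⨅ y, f y := le_ciInf fun y => by linarith [hc x y]
      linarith⟩
  have h := (hasSubgaussianMGF_of_mem_Icc hf.aemeasurable (.of_forall hmem) (μ := P)).mgf_le s
  refine h.trans_eq ?_
  congr 1
  simp only [add_sub_cancel_left, NNReal.coe_pow, NNReal.coe_div, coe_nnnorm, Real.norm_eq_abs,
    NNReal.coe_ofNat, div_pow, sq_abs]
  ring

/-- Induction on the number of coordinates. Averaging out the first one leaves a function with the
remaining difference bounds, while Hoeffding's lemma with the other coordinates frozen contributes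
the factor `exp (s² c₀² / 8)`. -/
lemma integral_exp_le_of_bounded_differences_fin {E : Type*} [MeasurableSpace E] (P : Measure E)
    [IsProbabilityMeasure P] {N : ℕ} {f : (Fin N → E) → ℝ} (hf : Measurable f) {C : ℝ}
    (hC : ∀ x, |f x| ≤ C) {c : Fin N → ℝ}
    (hc : ∀ x i y, f (Function.update x i y) - f x ≤ c i) (s : ℝ) :
    ∫ x, Real.exp (s * (f x - ∫ y, f y ∂(Measure.pi fun _ => P))) ∂(Measure.pi fun _ => P)
      ≤ Real.exp (s ^ 2 * (∑ i, c i ^ 2) / 8) := by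
  induction N with
  | zero =>
    have h : ∀ x, f x = f Fin.elim0 := fun x => congrArg f (Subsingleton.elim _ _)
    simp [h]
  | succ N ih =>
    set Q : Measure (Fin N → E) := Measure.pi fun _ => P with hQ
    have hmp := (measurePreserving_piFinSuccAbove (fun _ : Fin (N + 1) => P) 0).symm
    set g : E × (Fin N → E) → ℝ := fun p => f (Fin.cons p.1 p.2) with hg
    have hcons : Measurable fun p : E × (Fin N → E) => (Fin.cons p.1 p.2 : Fin (N + 1) → E) := by
      refine measurable_pi_iff.2 fun i => ?_
      refine Fin.cases ?_ (fun j => ?_) i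
      · simpa using measurable_fst
      · simp only [Fin.cons_succ]
        exact (measurable_pi_apply j).comp measurable_snd
    have hgm : Measurable g := hf.comp hcons
    have hgC : ∀ p, |g p| ≤ C := fun p => hC _
    have htr : ∀ φ : ℝ → ℝ, ∫ x, φ (f x) ∂(Measure.pi fun _ : Fin (N + 1) => P)
        = ∫ p, φ (g p) ∂(P.prod Q) := by
      intro φ
      rw [← hmp.integral_comp' (g := fun x => φ (f x))]
      refine integral_congr_ae (.of_forall fun p => ?_)
      simp only [hg, MeasurableEquiv.piFinSuccAbove_symm_apply, Fin.insertNthEquiv,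
        Equiv.coe_fn_mk, Fin.insertNth_zero']
    set h : (Fin N → E) → ℝ := fun x => ∫ y, g (y, x) ∂P with hh
    have hhm : Measurable h :=
      (hgm.stronglyMeasurable.integral_prod_left (μ := P)).measurable
    have hhC : ∀ x, |h x| ≤ C := fun x => abs_integral_le_of_abs_le fun y => hgC _
    have hslice : ∀ x, Integrable (fun y => g (y, x)) P := fun x =>
      integrable_of_abs_le (hgm.comp (measurable_id.prodMk measurable_const)) fun y => hgC _
    have hmean : ∫ x, f x ∂(Measure.pi fun _ : Fin (N + 1) => P) = ∫ x, h x ∂Q := by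
      rw [htr fun t => t, integral_prod_symm _ (integrable_of_abs_le hgm hgC)]
    have hhc : ∀ x i y, h (Function.update x i y) - h x ≤ c i.succ := by
      intro x i y
      rw [hh]
      simp only
      rw [← integral_sub (hslice _) (hslice _)]
      calc ∫ z, (g (z, Function.update x i y) - g (z, x)) ∂P ≤ ∫ _, c i.succ ∂P := by
            refine integral_mono ((hslice _).sub (hslice _)) (integrable_const _) fun z => ?_
            have := hc (Fin.cons z x) i.succ y
            rwa [← Fin.cons_update] at this
        _ = c i.succ := by simp
    have hih := ih hhm hhC hhc
    set M := ∫ x, h x ∂Q with hM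
    have hMC : |M| ≤ C := abs_integral_le_of_abs_le hhC
    have hexp : ∀ u : ℝ, |u| ≤ 2 * C → |Real.exp (s * u)| ≤ Real.exp (|s| * (2 * C)) := by
      intro u hu
      rw [abs_of_pos (Real.exp_pos _)]
      refine Real.exp_le_exp.2 ((le_abs_self _).trans ?_)
      rw [abs_mul]
      gcongr
    have habs : ∀ u v : ℝ, |u| ≤ C → |v| ≤ C → |u - v| ≤ 2 * C := fun u v hu hv => by
      have := abs_sub u v
      linarith
    rw [hmean, htr fun t => Real.exp (s * (t - M)), integral_prod_symm _
      (integrable_of_abs_le (((hgm.sub_const M).const_mul s).exp)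
        fun p => hexp _ (habs _ _ (hgC p) hMC))]
    have hinner : ∀ x, ∫ y, Real.exp (s * (g (y, x) - M)) ∂P
        ≤ Real.exp (s ^ 2 * c 0 ^ 2 / 8) * Real.exp (s * (h x - M)) := by
      intro x
      have e : ∀ y, Real.exp (s * (g (y, x) - M))
          = Real.exp (s * (g (y, x) - h x)) * Real.exp (s * (h x - M)) := fun y => by
        rw [← Real.exp_add]; ring_nf
      simp_rw [e]
      rw [integral_mul_const]
      refine mul_le_mul_of_nonneg_right ?_ (Real.exp_pos _).le
      refine integral_exp_mul_sub_integral_le P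
        (hgm.comp (measurable_id.prodMk measurable_const)) (fun y => hgC _) (fun y z => ?_) s
      have := hc (Fin.cons z x) 0 y
      rwa [Fin.update_cons_zero] at this
    calc ∫ x, ∫ y, Real.exp (s * (g (y, x) - M)) ∂P ∂Q
        ≤ ∫ x, Real.exp (s ^ 2 * c 0 ^ 2 / 8) * Real.exp (s * (h x - M)) ∂Q := by
          refine integral_mono_of_nonneg (.of_forall fun x => integral_nonneg fun y =>
            (Real.exp_pos _).le) ?_ (.of_forall hinner)
          exact (integrable_of_abs_le (((hhm.sub_const M).const_mul s).exp)
            fun x => hexp _ (habs _ _ (hhC x) hMC)).const_mul _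
      _ ≤ Real.exp (s ^ 2 * c 0 ^ 2 / 8) * Real.exp (s ^ 2 * (∑ i : Fin N, c i.succ ^ 2) / 8) := by
          rw [integral_const_mul]
          exact mul_le_mul_of_nonneg_left hih (Real.exp_pos _).le
      _ = _ := by
          rw [← Real.exp_add, Fin.sum_univ_succ]
          ring_nf

lemma measurePreserving_comp_equiv {ι ι' E : Type*} [Fintype ι] [Fintype ι'] [MeasurableSpace E]
    (P : Measure E) [IsProbabilityMeasure P] (e : ι' ≃ ι) :
    MeasurePreserving (fun (x : ι' → E) j => x (e.symm j)) (Measure.pi fun _ => P)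
      (Measure.pi fun _ => P) := by
  convert! measurePreserving_piCongrLeft (fun _ : ι => P) e using 1
  ext x j
  obtain ⟨i, rfl⟩ := e.surjective j
  rw [MeasurableEquiv.coe_piCongrLeft, Equiv.piCongrLeft_apply_apply]
  simp

/-- **McDiarmid's inequality** for independent and identically distributed variables. -/
theorem measure_integral_add_le_of_bounded_differences {ι E : Type*} [Fintype ι] [DecidableEq ι]
    [MeasurableSpace E] (P : Measure E) [IsProbabilityMeasure P] {f : (ι → E) → ℝ}
    (hf : Measurable f) {C : ℝ} (hC : ∀ x, |f x| ≤ C) {c : ι → ℝ}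
    (hc : ∀ x i y, f (Function.update x i y) - f x ≤ c i) {t : ℝ} (ht : 0 ≤ t) :
    (Measure.pi fun _ => P) {x | ∫ y, f y ∂(Measure.pi fun _ => P) + t ≤ f x}
      ≤ ENNReal.ofReal (Real.exp (-(2 * t ^ 2 / ∑ i, c i ^ 2))) := by
  set e := (Fintype.equivFin ι).symm
  have hmp := measurePreserving_comp_equiv P e
  set T : (Fin (Fintype.card ι) → E) → ι → E := fun x j => x (e.symm j) with hT
  have hmean : ∫ y, f y ∂(Measure.pi fun _ => P) = ∫ x, f (T x) ∂(Measure.pi fun _ => P) := by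
    rw [← hmp.map_eq, integral_map hmp.measurable.aemeasurable hf.aestronglyMeasurable]
  have hfT : Measurable (f ∘ T) := hf.comp hmp.measurable
  set M := ∫ x, f (T x) ∂(Measure.pi fun _ => P) with hM
  have hMC : |M| ≤ C := abs_integral_le_of_abs_le fun x => hC _
  have hsum : 0 ≤ (∑ i, c i ^ 2) / 4 := by positivity
  have hsub : HasSubgaussianMGF (fun x => f (T x) - M) ((∑ i, c i ^ 2) / 4).toNNReal
      (Measure.pi fun _ => P) := by
    constructor
    · intro s
      refine integrable_of_abs_le (C := Real.exp (|s| * (2 * C)))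
        (((hfT.sub_const M).const_mul s).exp) fun x => ?_
      rw [abs_of_pos (Real.exp_pos _)]
      refine Real.exp_le_exp.2 ((le_abs_self _).trans ?_)
      rw [abs_mul]
      gcongr
      have := abs_sub (f (T x)) M
      linarith [hC (T x)]
    · intro s
      have hb := integral_exp_le_of_bounded_differences_fin P hfT (fun x => hC (T x))
        (c := fun i => c (e i)) (fun x i y => by
          have h1 : T (Function.update x i y) = Function.update (T x) (e i) y := by
            ext j
            simp only [hT, Function.update_apply, Equiv.symm_apply_eq]
          have := hc (T x) (e i) y
          rwa [← h1] at this) s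
      rw [mgf]
      refine hb.trans_eq ?_
      rw [Real.coe_toNNReal _ hsum, e.sum_comp fun i => c i ^ 2]
      ring_nf
  have h := hsub.measure_ge_le ht
  rw [Real.coe_toNNReal _ hsum] at h
  have hset : MeasurableSet {x | ∫ y, f y ∂(Measure.pi fun _ => P) + t ≤ f x} :=
    measurableSet_le measurable_const hf
  rw [← hmp.measure_preimage hset.nullMeasurableSet, ← ofReal_measureReal]
  refine ENNReal.ofReal_le_ofReal ?_
  have e1 : T ⁻¹' {x | ∫ y, f y ∂(Measure.pi fun _ => P) + t ≤ f x}
      = {x | t ≤ f (T x) - M} := by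
    ext x
    simp only [Set.mem_preimage, Set.mem_ofPred_eq, hmean]
    constructor <;> intro h <;> linarith
  rw [e1]
  refine h.trans_eq ?_
  congr 1
  -- If all differences vanish, division by zero is `0` and both bounds read `exp 0 = 1`.
  rcases eq_or_ne (∑ i, c i ^ 2) 0 with h0 | h0
  · simp [h0]
  · field_simp; ring

/-! ### Concentration of kernel mean embeddings -/

section Feature

variable {Z : Type*} (H : Type*) [NormedAddCommGroup H] [InnerProductSpace ℝ H]
  [CompleteSpace H] [RKHS ℝ H Z ℝ]

/-- The kernel section `K(·, z)` as an element of the RKHS. -/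
def feature (z : Z) : H := RKHS.kerFun H z (1 : ℝ)

variable {H} in
lemma inner_feature_right (f : H) (z : Z) : inner ℝ f (feature H z) = f z := by
  simp [feature]

lemma inner_feature_feature (z z' : Z) :
    inner ℝ (feature H z) (feature H z') = realKernel H z z' := by
  rw [feature, RKHS.kerFun_inner, feature, RKHS.kerFun_apply]
  simp [realKernel]

variable {H} {κ : ℝ}

lemma norm_feature_le (hκ : 0 ≤ κ) {z : Z} (hK : realKernel H z z ≤ κ ^ 2) :
    ‖feature H z‖ ≤ κ := by
  refine abs_le_of_sq_le_sq' ?_ hκ |>.2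
  rw [← real_inner_self_eq_norm_sq, inner_feature_feature]
  exact hK

/-- Nonnegativity of the kernel lets the cross term be dropped, improving the triangle-inequality
constant `2κ` to `√2 κ`. -/
lemma norm_feature_sub_feature_le (hκ : 0 ≤ κ)
    (hK : ∀ z z' : Z, 0 ≤ realKernel H z z' ∧ realKernel H z z' ≤ κ ^ 2) (z z' : Z) :
    ‖feature H z - feature H z'‖ ≤ √2 * κ := by
  refine abs_le_of_sq_le_sq' ?_ (by positivity) |>.2
  rw [norm_sub_sq_real, ← real_inner_self_eq_norm_sq, ← real_inner_self_eq_norm_sq,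
    inner_feature_feature, inner_feature_feature, inner_feature_feature, mul_pow,
    Real.sq_sqrt (by norm_num)]
  linarith [(hK z z').1, (hK z z).2, (hK z' z').2]

variable (H)

/-- The norm of the linear combination `∑ i, a i • K(·, z i)` of kernel sections. -/
def embeddingNorm {ι : Type*} [Fintype ι] (a : ι → ℝ) (z : ι → Z) : ℝ :=
  ‖∑ i, a i • feature H (z i)‖

variable {ι : Type*} [Fintype ι]

lemma embeddingNorm_sq (a : ι → ℝ) (z : ι → Z) :
    embeddingNorm H a z ^ 2 = ∑ i, ∑ j, a i * a j * realKernel H (z i) (z j) := by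
  rw [embeddingNorm, ← real_inner_self_eq_norm_sq, sum_inner]
  refine Finset.sum_congr rfl fun i _ => ?_
  rw [inner_sum]
  refine Finset.sum_congr rfl fun j _ => ?_
  rw [real_inner_smul_left, real_inner_smul_right, inner_feature_feature]
  ring

lemma embeddingNorm_nonneg (a : ι → ℝ) (z : ι → Z) : 0 ≤ embeddingNorm H a z := norm_nonneg _

variable {H}

lemma embeddingNorm_le (hκ : 0 ≤ κ)
    (hK : ∀ z z' : Z, 0 ≤ realKernel H z z' ∧ realKernel H z z' ≤ κ ^ 2) (a : ι → ℝ)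
    (z : ι → Z) : embeddingNorm H a z ≤ ∑ i, |a i| * κ := by
  refine (norm_sum_le _ _).trans (Finset.sum_le_sum fun i _ => ?_)
  rw [norm_smul, Real.norm_eq_abs]
  exact mul_le_mul_of_nonneg_left (norm_feature_le hκ (hK _ _).2) (abs_nonneg _)

lemma embeddingNorm_update_sub_le [DecidableEq ι] (hκ : 0 ≤ κ)
    (hK : ∀ z z' : Z, 0 ≤ realKernel H z z' ∧ realKernel H z z' ≤ κ ^ 2) (a : ι → ℝ)
    (z : ι → Z) (i : ι) (y : Z) :
    embeddingNorm H a (Function.update z i y) - embeddingNorm H a z ≤ |a i| * (√2 * κ) := by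
  refine (norm_sub_norm_le _ _).trans ?_
  rw [← Finset.sum_sub_distrib, Finset.sum_eq_single i]
  · rw [Function.update_self, ← smul_sub, norm_smul, Real.norm_eq_abs]
    exact mul_le_mul_of_nonneg_left (norm_feature_sub_feature_le hκ hK _ _) (abs_nonneg _)
  · intro j _ hj
    rw [Function.update_of_ne hj, sub_self]
  · simp

variable [MeasurableSpace Z]

/-- `H` carries no σ-algebra and need not be separable, so measurability is read off the Gram
expansion of the squared norm. -/
lemma measurable_embeddingNorm
    (hKm : Measurable fun z : Z × Z => realKernel H z.1 z.2) (a : ι → ℝ) :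
    Measurable (embeddingNorm H a : (ι → Z) → ℝ) := by
  have h : (embeddingNorm H a : (ι → Z) → ℝ)
      = fun z => √(∑ i, ∑ j, a i * a j * realKernel H (z i) (z j)) := by
    funext z
    rw [← embeddingNorm_sq, Real.sqrt_sq (embeddingNorm_nonneg H a z)]
  have hpair : ∀ i j, Measurable fun z : ι → Z => a i * a j * realKernel H (z i) (z j) := by
    intro i j
    have h1 : Measurable fun z : ι → Z => (z i, z j) :=
      (measurable_pi_apply i).prodMk (measurable_pi_apply j)
    have h2 := hKm.comp h1
    simp only [Function.comp_def] at h2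
    exact h2.const_mul (a i * a j)
  rw [h]
  refine Measurable.sqrt ?_
  refine Finset.measurable_sum _ fun i _ => ?_
  exact Finset.measurable_sum _ fun j _ => hpair i j

/-- With `d` and `k` the diagonal and off-diagonal kernel means, the second moment is `(d - k) ∑ aᵢ²
+ k (∑ aᵢ)²`. Centering kills the last term, and `k ≥ 0`, `d ≤ κ²`. -/
lemma integral_embeddingNorm_sq_le [DecidableEq ι]
    (hK : ∀ z z' : Z, 0 ≤ realKernel H z z' ∧ realKernel H z z' ≤ κ ^ 2)
    (hKm : Measurable fun z : Z × Z => realKernel H z.1 z.2) (P : Measure Z)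
    [IsProbabilityMeasure P] {a : ι → ℝ} (ha : ∑ i, a i = 0) :
    ∫ z, embeddingNorm H a z ^ 2 ∂(Measure.pi fun _ => P) ≤ κ ^ 2 * ∑ i, a i ^ 2 := by
  have habs : ∀ z z' : Z, |realKernel H z z'| ≤ κ ^ 2 := fun z z' => by
    rw [abs_of_nonneg (hK z z').1]; exact (hK z z').2
  have hpair : ∀ i j, Measurable fun z : ι → Z => (z i, z j) := fun i j =>
    (measurable_pi_apply i).prodMk (measurable_pi_apply j)
  have hint : ∀ i j, Integrable (fun z : ι → Z => a i * a j * realKernel H (z i) (z j))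
      (Measure.pi fun _ => P) := fun i j =>
    (integrable_of_abs_le (hKm.comp (hpair i j)) fun z => habs _ _).const_mul _
  set k := ∫ p, realKernel H p.1 p.2 ∂(P.prod P) with hk
  set d := ∫ z, realKernel H z z ∂P with hd
  have hdiag : ∀ i, ∫ z : ι → Z, realKernel H (z i) (z i) ∂(Measure.pi fun _ => P) = d :=
    fun i => integral_comp_eval (μ := fun _ : ι => P) (i := i) (f := fun z => realKernel H z z)
      (hKm.comp (measurable_id.prodMk measurable_id)).aestronglyMeasurable
  have hoff : ∀ i j, i ≠ j →
      ∫ z : ι → Z, realKernel H (z i) (z j) ∂(Measure.pi fun _ => P) = k := by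
    intro i j hij
    have hind : iIndepFun (fun i (z : ι → Z) => z i) (Measure.pi fun _ : ι => P) :=
      iIndepFun_pi (X := fun _ => id) fun _ => aemeasurable_id
    have h := (indepFun_iff_map_prod_eq_prod_map_map (measurable_pi_apply i).aemeasurable
      (measurable_pi_apply j).aemeasurable).1 (hind.indepFun hij)
    rw [(measurePreserving_eval (fun _ : ι => P) i).map_eq,
      (measurePreserving_eval (fun _ : ι => P) j).map_eq] at h
    rw [hk, ← h, integral_map (hpair i j).aemeasurable hKm.aestronglyMeasurable]
  have hk0 : 0 ≤ k := integral_nonneg fun p => (hK _ _).1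
  have hd1 : d ≤ κ ^ 2 := (le_abs_self _).trans (abs_integral_le_of_abs_le fun z => habs z z)
  simp_rw [embeddingNorm_sq]
  rw [integral_finsetSum _ fun i _ => integrable_finsetSum _ fun j _ => hint i j]
  have hterm : ∀ i, ∫ z : ι → Z, ∑ j, a i * a j * realKernel H (z i) (z j)
      ∂(Measure.pi fun _ => P) = a i ^ 2 * (d - k) + a i * k * ∑ j, a j := by
    intro i
    rw [integral_finsetSum _ fun j _ => hint i j]
    have : ∀ j, ∫ z : ι → Z, a i * a j * realKernel H (z i) (z j) ∂(Measure.pi fun _ => P)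
        = (if j = i then a i ^ 2 * (d - k) else 0) + a i * k * a j := by
      intro j
      rw [integral_const_mul]
      split_ifs with h
      · subst h; rw [hdiag]; ring
      · rw [hoff i j (Ne.symm h)]; ring
    simp_rw [this]
    rw [Finset.sum_add_distrib, Finset.sum_ite_eq' Finset.univ i, ← Finset.mul_sum]
    simp
  simp_rw [hterm, ha, mul_zero, add_zero]
  rw [← Finset.sum_mul, mul_comm]
  exact mul_le_mul_of_nonneg_right (by linarith) (Finset.sum_nonneg fun i _ => sq_nonneg _)

/-- Concentration of the norm of a centered linear combination of the embeddings of independent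
and identically distributed points. -/
theorem measure_lt_embeddingNorm_le [DecidableEq ι] (hκ : 0 ≤ κ)
    (hK : ∀ z z' : Z, 0 ≤ realKernel H z z' ∧ realKernel H z z' ≤ κ ^ 2)
    (hKm : Measurable fun z : Z × Z => realKernel H z.1 z.2) (P : Measure Z)
    [IsProbabilityMeasure P] {a : ι → ℝ} (ha : ∑ i, a i = 0) {L : ℝ} (hL : 0 ≤ L) :
    (Measure.pi fun _ => P) {z | κ * (1 + √L) * √(∑ i, a i ^ 2) < embeddingNorm H a z}
      ≤ ENNReal.ofReal (Real.exp (-L)) := by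
  have hm := measurable_embeddingNorm hKm a
  have habs : ∀ z : ι → Z, |embeddingNorm H a z| ≤ ∑ i, |a i| * κ := fun z => by
    rw [abs_of_nonneg (embeddingNorm_nonneg H a z)]; exact embeddingNorm_le hκ hK a z
  set σ := √(∑ i, a i ^ 2) with hσ
  have hσ0 : 0 ≤ σ := Real.sqrt_nonneg _
  have hσ2 : σ ^ 2 = ∑ i, a i ^ 2 := Real.sq_sqrt (Finset.sum_nonneg fun i _ => sq_nonneg _)
  -- When `κσ = 0` the McDiarmid bound degenerates to `1`, but the norm is then identically zero.
  rcases (mul_nonneg hκ hσ0).eq_or_lt with h0 | h0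
  · suffices hempty : {z | κ * (1 + √L) * σ < embeddingNorm H a z} = ∅ by
      rw [hempty, measure_empty]; exact zero_le
    refine Set.eq_empty_of_forall_notMem fun z hz => ?_
    have h1 : embeddingNorm H a z ≤ 0 := by
      refine (embeddingNorm_le hκ hK a z).trans ?_
      rcases mul_eq_zero.1 h0.symm with h | h
      · simp [h]
      · rw [h, zero_pow two_ne_zero, eq_comm,
          Finset.sum_eq_zero_iff_of_nonneg fun i _ => sq_nonneg _] at hσ2
        refine (Finset.sum_eq_zero fun i hi => ?_).le
        rw [pow_eq_zero_iff two_ne_zero |>.1 (hσ2 i hi)]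
        simp
    have h2 : κ * (1 + √L) * σ = 0 := by rw [mul_right_comm, ← h0, zero_mul]
    simp only [Set.mem_ofPred_eq, h2] at hz
    linarith
  · have hmean : ∫ z, embeddingNorm H a z ∂(Measure.pi fun _ => P) ≤ κ * σ := by
      refine abs_le_of_sq_le_sq' ?_ h0.le |>.2
      have hLp : MemLp (embeddingNorm H a : (ι → Z) → ℝ) 2 (Measure.pi fun _ => P) :=
        MemLp.of_bound hm.aestronglyMeasurable _ (.of_forall fun z => habs z)
      have hv := variance_nonneg (embeddingNorm H a : (ι → Z) → ℝ) (Measure.pi fun _ => P)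
      rw [variance_eq_sub hLp] at hv
      have := integral_embeddingNorm_sq_le hK hKm P ha
      rw [mul_pow, hσ2]
      simp only [Pi.pow_apply] at hv
      linarith
    -- The squared increments sum to `2 (κσ)²`, so the deviation `κσ√L` gives exponent exactly `L`.
    have hmd := measure_integral_add_le_of_bounded_differences P hm habs
      (embeddingNorm_update_sub_le hκ hK a) (t := κ * σ * √L) (by positivity)
    have hexp : 2 * (κ * σ * √L) ^ 2 / ∑ i, (|a i| * (√2 * κ)) ^ 2 = L := by
      have e : ∑ i, (|a i| * (√2 * κ)) ^ 2 = 2 * (κ * σ) ^ 2 := by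
        simp_rw [mul_pow, sq_abs]
        rw [← Finset.sum_mul, ← hσ2, Real.sq_sqrt (by norm_num : (0 : ℝ) ≤ 2)]
        ring
      rw [e, mul_pow _ √L, Real.sq_sqrt hL]
      generalize κ * σ = y at h0
      field_simp
    rw [hexp] at hmd
    refine (measure_mono fun z hz => ?_).trans hmd
    simp only [Set.mem_ofPred_eq] at hz ⊢
    have : κ * (1 + √L) * σ = κ * σ + κ * σ * √L := by ring
    linarith

end Feature

/-! ### The kernel quadratic program -/

section Program

variable {𝒳 : Type*} {n m c r : ℕ} (H : Type*) [NormedAddCommGroup H] [InnerProductSpace ℝ H]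
  [CompleteSpace H] [RKHS ℝ H (𝒳 × Fin c) ℝ]

/-- The kernel mean embedding of the weighted calibration instances. -/
def calEmbedding (x : Fin n → 𝒳) (w : Fin n × Fin c → ℝ) : H :=
  (1 / (n : ℝ)) • ∑ p, w p • feature H (x p.1, p.2)

/-- The kernel mean embedding of the training samples. -/
def trainEmbedding (ztr : Fin m → 𝒳 × Fin c) : H :=
  (1 / (m : ℝ)) • ∑ j, feature H (ztr j)

lemma realKernel_comm {Z : Type*} (H : Type*) [NormedAddCommGroup H] [InnerProductSpace ℝ H]
    [CompleteSpace H] [RKHS ℝ H Z ℝ] (z z' : Z) : realKernel H z z' = realKernel H z' z := by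
  rw [← inner_feature_feature, ← inner_feature_feature, real_inner_comm]

lemma kernelObjective_eq_norm (x : Fin n → 𝒳) (ztr : Fin m → 𝒳 × Fin c)
    (w : Fin n × Fin c → ℝ) :
    kernelObjective H x ztr w = ‖calEmbedding H x w - trainEmbedding H ztr‖ := by
  rw [kernelObjective, ← Real.sqrt_sq (norm_nonneg (calEmbedding H x w - trainEmbedding H ztr))]
  congr 1
  rw [norm_sub_sq_real, ← real_inner_self_eq_norm_sq, ← real_inner_self_eq_norm_sq]
  have h1 : inner ℝ (calEmbedding H x w) (calEmbedding H x w) = 1 / (n : ℝ) ^ 2 *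
      (w ⬝ᵥ (Matrix.of fun p q : Fin n × Fin c =>
        realKernel H (x p.1, p.2) (x q.1, q.2)).mulVec w) := by
    simp only [calEmbedding, real_inner_smul_left, real_inner_smul_right, sum_inner, inner_sum,
      inner_feature_feature, dotProduct, Matrix.mulVec, Matrix.of_apply, Finset.mul_sum]
    refine Finset.sum_congr rfl fun p _ => Finset.sum_congr rfl fun q _ => ?_
    rw [realKernel_comm]
    ring
  have h2 : inner ℝ (trainEmbedding H ztr) (trainEmbedding H ztr) = 1 / (m : ℝ) ^ 2 *
      ((1 : Fin m → ℝ) ⬝ᵥ (Matrix.of fun i j => realKernel H (ztr i) (ztr j)).mulVec 1) := by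
    simp only [trainEmbedding, real_inner_smul_left, real_inner_smul_right, sum_inner, inner_sum,
      inner_feature_feature, dotProduct, Matrix.mulVec, Matrix.of_apply, Finset.mul_sum,
      Pi.one_apply]
    refine Finset.sum_congr rfl fun p _ => Finset.sum_congr rfl fun q _ => ?_
    rw [realKernel_comm]
    ring
  have h3 : 2 * inner ℝ (calEmbedding H x w) (trainEmbedding H ztr) = 2 / ((n : ℝ) * m) *
      ((fun p : Fin n × Fin c => ∑ j, realKernel H (x p.1, p.2) (ztr j)) ⬝ᵥ w) := by
    simp only [calEmbedding, trainEmbedding, real_inner_smul_left, real_inner_smul_right,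
      sum_inner, inner_sum, inner_feature_feature, dotProduct, Finset.mul_sum, Finset.sum_mul]
    rw [Finset.sum_comm]
    refine Finset.sum_congr rfl fun p _ => Finset.sum_congr rfl fun q _ => ?_
    ring
  rw [h1, h2, h3]

/-- Stated for a module so as to serve both the embedding (`V = H`) and the coverage (`V = ℝ`). -/
lemma sum_trueWeights_smul {V : Type*} [AddCommGroup V] [Module ℝ V]
    (zcal : Fin n → 𝒳 × Fin c) (g : 𝒳 × Fin c → V) :
    ∑ p, trueWeights zcal p • g ((zcal p.1).1, p.2) = ∑ i, g (zcal i) := by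
  rw [Fintype.sum_prod_type]
  refine Finset.sum_congr rfl fun i _ => ?_
  rw [Finset.sum_eq_single (zcal i).2]
  · simp [trueWeights]
  · intro y _ hy
    simp [trueWeights, hy]
  · simp

/-- The coefficients of the difference of the empirical measures of two samples. -/
def twoSampleCoeff (n m : ℕ) : Fin m ⊕ Fin n → ℝ :=
  Sum.elim (fun _ => -(1 / (m : ℝ))) fun _ => 1 / (n : ℝ)

lemma sum_twoSampleCoeff (hn : 0 < n) (hm : 0 < m) : ∑ i, twoSampleCoeff n m i = 0 := by
  have hn' : (n : ℝ) ≠ 0 := by exact_mod_cast hn.ne'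
  have hm' : (m : ℝ) ≠ 0 := by exact_mod_cast hm.ne'
  simp [twoSampleCoeff, hn', hm']

lemma sum_twoSampleCoeff_sq (hn : 0 < n) (hm : 0 < m) :
    ∑ i, twoSampleCoeff n m i ^ 2 = 1 / (n : ℝ) + 1 / (m : ℝ) := by
  have hn' : (n : ℝ) ≠ 0 := by exact_mod_cast hn.ne'
  have hm' : (m : ℝ) ≠ 0 := by exact_mod_cast hm.ne'
  simp [twoSampleCoeff]
  field_simp
  ring

lemma kernelObjective_trueWeights (zcal : Fin n → 𝒳 × Fin c) (ztr : Fin m → 𝒳 × Fin c) :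
    kernelObjective H (fun i => (zcal i).1) ztr (trueWeights zcal)
      = embeddingNorm H (twoSampleCoeff n m) (Sum.elim ztr zcal) := by
  rw [kernelObjective_eq_norm, embeddingNorm]
  congr 1
  rw [calEmbedding, sum_trueWeights_smul zcal (feature H), trainEmbedding, Fintype.sum_sum_type]
  simp only [twoSampleCoeff, Sum.elim_inl, Sum.elim_inr, neg_smul, Finset.sum_neg_distrib,
    Finset.smul_sum]
  abel

/-- The average over the instances of the total weight of the covered labels. -/
def weightedCover (x : Fin n → 𝒳) (w : Fin n × Fin c → ℝ) (C : 𝒳 → Set (Fin c)) : ℝ :=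
  1 / (n : ℝ) * ∑ p, w p * coverIndicator C (x p.1, p.2)

lemma weightedCover_trueWeights (zcal : Fin n → 𝒳 × Fin c) (C : 𝒳 → Set (Fin c)) :
    weightedCover (fun i => (zcal i).1) (trueWeights zcal) C
      = empFreq zcal {z | z.2 ∈ C z.1} := by
  rw [weightedCover, empFreq]
  congr 1
  exact sum_trueWeights_smul zcal (coverIndicator C)

lemma le_one_of_mem_feasibleSet {B : Matrix (Fin r) (Fin n × Fin c) ℝ} {b : Fin r → ℝ}
    {w : Fin n × Fin c → ℝ} (hw : w ∈ feasibleSet B b) (p : Fin n × Fin c) : w p ≤ 1 := by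
  rw [← hw.2.1 p.1]
  exact Finset.single_le_sum (f := fun y => w (p.1, y)) (fun y _ => hw.1 (p.1, y))
    (Finset.mem_univ p.2)

lemma coverIndicator_nonneg (C : 𝒳 → Set (Fin c)) (z : 𝒳 × Fin c) : 0 ≤ coverIndicator C z :=
  Set.indicator_nonneg (fun _ _ => zero_le_one) _

/-- The remainder `𝔛_C - f` is paid at weight differences of at most one. The part `f` is, by the
reproducing property, an inner product with the difference of two embeddings; passing through the
training embedding and using optimality of `w` gives the factor `2`. -/
lemma abs_weightedCover_sub_le {x : Fin n → 𝒳} {ztr : Fin m → 𝒳 × Fin c}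
    {B : Matrix (Fin r) (Fin n × Fin c) ℝ} {b : Fin r → ℝ} {w w' : Fin n × Fin c → ℝ}
    (hw : IsKernelSolution H x ztr B b w) (hw' : w' ∈ feasibleSet B b)
    (C : 𝒳 → Set (Fin c)) (f : H) :
    |weightedCover x w C - weightedCover x w' C|
      ≤ approxError x C f + 2 * kernelObjective H x ztr w' * ‖f‖ := by
  have hdiff : weightedCover x w C - weightedCover x w' C
      = 1 / (n : ℝ) * ∑ p, (w p - w' p) * (coverIndicator C (x p.1, p.2) - f (x p.1, p.2))
        + inner ℝ f (calEmbedding H x w - calEmbedding H x w') := by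
    simp only [weightedCover, calEmbedding, inner_sub_right, real_inner_smul_right, inner_sum,
      inner_feature_right]
    rw [← mul_sub, ← mul_sub, ← mul_add, ← Finset.sum_sub_distrib, ← Finset.sum_sub_distrib,
      ← Finset.sum_add_distrib]
    congr 1
    refine Finset.sum_congr rfl fun p _ => ?_
    ring
  rw [hdiff]
  refine (abs_add_le _ _).trans (add_le_add ?_ ?_)
  · rw [abs_mul, abs_of_nonneg (by positivity : (0 : ℝ) ≤ 1 / n), approxError]
    refine mul_le_mul_of_nonneg_left ?_ (by positivity)
    refine (Finset.abs_sum_le_sum_abs _ _).trans (Finset.sum_le_sum fun p _ => ?_)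
    rw [abs_mul]
    have h1 : |w p - w' p| ≤ 1 := by
      have a1 := le_one_of_mem_feasibleSet hw.1 p
      have a2 := le_one_of_mem_feasibleSet hw' p
      have a3 : 0 ≤ w p := hw.1.1 p
      have a4 : 0 ≤ w' p := hw'.1 p
      rw [abs_le]; constructor <;> linarith
    exact mul_le_of_le_one_left (abs_nonneg _) h1
  · refine (abs_real_inner_le_norm _ _).trans ?_
    rw [mul_comm]
    refine mul_le_mul_of_nonneg_right ?_ (norm_nonneg _)
    have h1 : kernelObjective H x ztr w ≤ kernelObjective H x ztr w' := hw.2 hw'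
    calc ‖calEmbedding H x w - calEmbedding H x w'‖
        ≤ ‖calEmbedding H x w - trainEmbedding H ztr‖
          + ‖calEmbedding H x w' - trainEmbedding H ztr‖ := by
          rw [norm_sub_rev (calEmbedding H x w')]
          exact norm_sub_le_norm_sub_add_norm_sub _ _ _
      _ ≤ _ := by
          rw [← kernelObjective_eq_norm, ← kernelObjective_eq_norm]
          linarith

end Program

/-! ### The excess gap -/

section Gap

variable {𝒳 : Type*} {n m c : ℕ} {H : Type*} [NormedAddCommGroup H] [InnerProductSpace ℝ H]
  [RKHS ℝ H (𝒳 × Fin c) ℝ]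

lemma approxError_nonneg (x : Fin n → 𝒳) (C : 𝒳 → Set (Fin c)) (f : H) :
    0 ≤ approxError x C f :=
  mul_nonneg (by positivity) (Finset.sum_nonneg fun _ _ => abs_nonneg _)

lemma varianceFactor_nonneg {κ : ℝ} (hκ : 0 ≤ κ) (δ : ℝ) : 0 ≤ varianceFactor n m κ δ := by
  unfold varianceFactor; positivity

lemma continuous_approxError (x : Fin n → 𝒳) (C : 𝒳 → Set (Fin c)) :
    Continuous fun f : H => approxError x C f := by
  unfold approxError
  refine continuous_const.mul (continuous_finsetSum _ fun p _ => ?_)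
  exact (continuous_const.sub (RKHS.continuous_eval (x p.1, p.2))).abs

/-- Representer theorem: projecting onto the span of the calibration features keeps all relevant
evaluations and does not increase the norm. On that finite-dimensional space a continuous coercive
function attains its minimum. -/
lemma exists_forall_gapObjective_le [CompleteSpace H] (hn : 0 < n) {κ : ℝ} (hκ : 0 ≤ κ)
    (hK : ∀ z : 𝒳 × Fin c, realKernel H z z ≤ κ ^ 2) (δ : ℝ) (x : Fin n → 𝒳)
    (C : 𝒳 → Set (Fin c)) :
    ∃ f : H, ∀ g : H, approxError x C f + varianceFactor n m κ δ * ‖f‖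
      ≤ approxError x C g + varianceFactor n m κ δ * ‖g‖ := by
  -- For `κ = 0` coercivity fails, but all features vanish, hence so does every function of `H`.
  rcases hκ.eq_or_lt with h0 | h0
  · refine ⟨0, fun g => ?_⟩
    have hg : ∀ (g : H) z, g z = 0 := by
      intro g z
      have h1 := norm_feature_le hκ (hK z)
      rw [← h0, norm_le_zero_iff] at h1
      rw [← inner_feature_right, h1, inner_zero_right]
    simp [approxError, hg, varianceFactor, ← h0]
  · have hv : 0 < varianceFactor n m κ δ := by
      have hn' : (0 : ℝ) < n := by exact_mod_cast hn
      unfold varianceFactor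
      positivity
    let V : Submodule ℝ H :=
      Submodule.span ℝ (Set.range fun p : Fin n × Fin c => feature H (x p.1, p.2))
    have hfin : FiniteDimensional ℝ V := FiniteDimensional.span_of_finite ℝ (Set.finite_range _)
    have hproper : ProperSpace V := FiniteDimensional.proper ℝ V
    let Φ : V → ℝ := fun f => approxError x C (f : H) + varianceFactor n m κ δ * ‖(f : H)‖
    have hΦ : Continuous Φ :=
      ((continuous_approxError x C).comp continuous_subtype_val).add
        (continuous_const.mul continuous_subtype_val.norm)
    have hlim : Filter.Tendsto Φ (Filter.cocompact V) Filter.atTop := by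
      refine Filter.tendsto_atTop_mono (fun f => ?_)
        ((tendsto_norm_cocompact_atTop (E := V)).const_mul_atTop hv)
      have := approxError_nonneg x C (f : H)
      simp only [Φ, Submodule.coe_norm]
      linarith
    obtain ⟨f, hf⟩ := hΦ.exists_forall_le hlim
    refine ⟨f, fun g => (hf (V.orthogonalProjectionOnto g)).trans ?_⟩
    simp only [Φ]
    have heval : ∀ p : Fin n × Fin c,
        (V.orthogonalProjectionOnto g : H) (x p.1, p.2) = g (x p.1, p.2) := by
      intro p
      have hp : feature H (x p.1, p.2) ∈ V := Submodule.subset_span ⟨p, rfl⟩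
      rw [← inner_feature_right, ← inner_feature_right]
      have := Submodule.starProjection_inner_eq_zero g (feature H (x p.1, p.2)) hp
      rw [inner_sub_left, sub_eq_zero] at this
      exact this.symm
    refine add_le_add ?_ (mul_le_mul_of_nonneg_left ?_ hv.le)
    · simp only [approxError, heval, le_refl]
    · exact V.norm_orthogonalProjectionOnto_apply_le g

lemma exists_eq_kernelGap [CompleteSpace H] (hn : 0 < n) {κ : ℝ} (hκ : 0 ≤ κ)
    (hK : ∀ z : 𝒳 × Fin c, realKernel H z z ≤ κ ^ 2) (δ : ℝ) (x : Fin n → 𝒳)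
    (C : 𝒳 → Set (Fin c)) :
    ∃ f : H, approxError x C f + varianceFactor n m κ δ * ‖f‖ = kernelGap H m κ δ x C := by
  obtain ⟨f, hf⟩ := exists_forall_gapObjective_le (m := m) hn hκ hK δ x C
  refine ⟨f, le_antisymm (le_ciInf hf)
    (ciInf_le ⟨approxError x C f + varianceFactor n m κ δ * ‖f‖, ?_⟩ f)⟩
  rintro _ ⟨g, rfl⟩
  exact hf g

lemma kernelGap_le {κ : ℝ} (hκ : 0 ≤ κ) (δ : ℝ) (x : Fin n → 𝒳) (C : 𝒳 → Set (Fin c))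
    (f : H) : kernelGap H m κ δ x C ≤ approxError x C f + varianceFactor n m κ δ * ‖f‖ := by
  refine ciInf_le ⟨0, ?_⟩ f
  rintro _ ⟨g, rfl⟩
  exact add_nonneg (approxError_nonneg x C g)
    (mul_nonneg (varianceFactor_nonneg hκ δ) (norm_nonneg _))

lemma kernelGap_nonneg {κ : ℝ} (hκ : 0 ≤ κ) (δ : ℝ) (x : Fin n → 𝒳) (C : 𝒳 → Set (Fin c)) :
    0 ≤ kernelGap H m κ δ x C :=
  le_ciInf fun g => add_nonneg (approxError_nonneg x C g)
    (mul_nonneg (varianceFactor_nonneg hκ δ) (norm_nonneg _))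

lemma isGLB_ballBias_add [CompleteSpace H] (hn : 0 < n) {κ : ℝ} (hκ : 0 ≤ κ)
    (hK : ∀ z : 𝒳 × Fin c, realKernel H z z ≤ κ ^ 2) (δ : ℝ) (x : Fin n → 𝒳)
    (C : 𝒳 → Set (Fin c)) :
    IsGLB ((fun R : ℝ => ballBias H x C R + varianceFactor n m κ δ * R) '' Set.Ioi 0)
      (kernelGap H m κ δ x C) := by
  have hv := varianceFactor_nonneg (n := n) (m := m) hκ δ
  constructor
  · rintro _ ⟨R, hR, rfl⟩
    have hne : Nonempty {f : H // ‖f‖ ≤ R} := ⟨⟨0, by simpa using (Set.mem_Ioi.1 hR).le⟩⟩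
    have : kernelGap H m κ δ x C - varianceFactor n m κ δ * R ≤ ballBias H x C R := by
      refine le_ciInf fun f => ?_
      have h1 := kernelGap_le (m := m) hκ δ x C f.1
      have h2 := mul_le_mul_of_nonneg_left f.2 hv
      linarith
    simp only
    linarith
  · intro l hl
    obtain ⟨f, hf⟩ := exists_eq_kernelGap (m := m) hn hκ hK δ x C
    rw [← hf]
    -- Radii must be positive and the minimizer `f` may be zero, so the radius `‖f‖ + η` is used and
    -- `η → 0`.
    have hb : ∀ η : ℝ, 0 < η →
        l ≤ approxError x C f + varianceFactor n m κ δ * (‖f‖ + η) := by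
      intro η hη
      have h1 := hl ⟨‖f‖ + η, Set.mem_Ioi.2 (by positivity), rfl⟩
      have h2 : ballBias H x C (‖f‖ + η) ≤ approxError x C f := by
        refine ciInf_le (f := fun g : {g : H // ‖g‖ ≤ ‖f‖ + η} => approxError x C g.1) ⟨0, ?_⟩
          ⟨f, by linarith⟩
        rintro _ ⟨g, rfl⟩
        exact approxError_nonneg x C g.1
      simp only at h1
      linarith
    have hlim : Filter.Tendsto
        (fun η : ℝ => approxError x C f + varianceFactor n m κ δ * (‖f‖ + η))
        (nhdsWithin 0 (Set.Ioi 0))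
        (nhds (approxError x C f + varianceFactor n m κ δ * (‖f‖ + 0))) :=
      Filter.Tendsto.mono_left (Continuous.tendsto (by fun_prop) 0) nhdsWithin_le_nhds
    rw [add_zero] at hlim
    exact ge_of_tendsto hlim (Filter.eventually_of_mem self_mem_nhdsWithin hb)

lemma abs_weightedCover_sub_le_kernelGap [CompleteSpace H] {r : ℕ} (hn : 0 < n) {κ : ℝ}
    (hκ : 0 ≤ κ) (hK : ∀ z : 𝒳 × Fin c, realKernel H z z ≤ κ ^ 2) (δ : ℝ) {x : Fin n → 𝒳}
    {ztr : Fin m → 𝒳 × Fin c} {B : Matrix (Fin r) (Fin n × Fin c) ℝ} {b : Fin r → ℝ}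
    {w w' : Fin n × Fin c → ℝ} (hw : IsKernelSolution H x ztr B b w)
    (hw' : w' ∈ feasibleSet B b) (C : 𝒳 → Set (Fin c))
    (hobj : kernelObjective H x ztr w'
      ≤ κ * (1 + √(Real.log (2 / δ))) * √(1 / (n : ℝ) + 1 / (m : ℝ))) :
    |weightedCover x w C - weightedCover x w' C| ≤ kernelGap H m κ δ x C := by
  obtain ⟨f, hf⟩ := exists_eq_kernelGap (m := m) hn hκ hK δ x C
  rw [← hf]
  refine (abs_weightedCover_sub_le H hw hw' C f).trans (add_le_add le_rfl ?_)
  refine mul_le_mul_of_nonneg_right ?_ (norm_nonneg f)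
  unfold varianceFactor
  linarith

end Gap

/-! ### The conformal quantile -/

section Quantile

/-- Just above `r` there is a threshold that separates the same values. -/
lemma exists_gt_forall_le_imp_le {ι : Type*} [Finite ι] (s : ι → ℝ) (r : ℝ) :
    ∃ q, r < q ∧ ∀ p, s p ≤ q → s p ≤ r := by
  have h : ∀ᶠ q in nhdsWithin r (Set.Ioi r), r < q ∧ ∀ p, s p ≤ q → s p ≤ r := by
    refine Filter.Eventually.and self_mem_nhdsWithin (Filter.eventually_all.2 fun p => ?_)
    rcases le_or_gt (s p) r with hp | hp
    · exact .of_forall fun q _ => hp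
    · filter_upwards [nhdsWithin_le_nhds (Iio_mem_nhds hp)] with q hq hpq
      exact absurd hpq (not_le.2 hq)
  exact h.exists

lemma exists_lt_forall_lt_imp_le {ι : Type*} [Finite ι] (s : ι → ℝ) (r : ℝ) :
    ∃ q, q < r ∧ ∀ p, s p < r → s p ≤ q := by
  have h : ∀ᶠ q in nhdsWithin r (Set.Iio r), q < r ∧ ∀ p, s p < r → s p ≤ q := by
    refine Filter.Eventually.and self_mem_nhdsWithin (Filter.eventually_all.2 fun p => ?_)
    rcases lt_or_ge (s p) r with hp | hp
    · filter_upwards [nhdsWithin_le_nhds (Ioi_mem_nhds hp)] with q hq _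
      exact le_of_lt hq
    · exact .of_forall fun q h => absurd h (not_lt.2 hp)
  exact h.exists

variable {ι : Type*} [Fintype ι] {s p : ι → ℝ} {β : ℝ}

lemma le_sum_of_quantile_lt (hp : ∀ i, 0 ≤ p i) {q : ℝ} (hq : quantile s p β < q) :
    β ≤ ∑ i, p i * (if s i ≤ q then 1 else 0) := by
  obtain ⟨_, ⟨q', hq', rfl⟩, hlt⟩ := sInf_lt_iff.1 hq
  have hlt' : q' < q := EReal.coe_lt_coe_iff.1 hlt
  refine le_trans (b := ∑ i, p i * (if s i ≤ q' then 1 else 0)) hq'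
    (Finset.sum_le_sum fun i _ => mul_le_mul_of_nonneg_left ?_ (hp i))
  by_cases h : s i ≤ q'
  · rw [if_pos h, if_pos (h.trans hlt'.le)]
  · rw [if_neg h]; split_ifs <;> norm_num

lemma sum_lt_of_lt_quantile {q : ℝ} (hq : (q : EReal) < quantile s p β) :
    ∑ i, p i * (if s i ≤ q then 1 else 0) < β := by
  by_contra! h
  refine absurd ?_ (not_le.2 hq)
  exact sInf_le ⟨q, h, rfl⟩

/-- The weight of the values up to the quantile is at least the level, up to the trivial cases of a
nonpositive level and of a level above the total weight. -/
lemma min_le_sum_quantile (hp : ∀ i, 0 ≤ p i) :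
    min β (∑ i, p i) ≤ max 0 (∑ i, p i * (if (s i : EReal) ≤ quantile s p β then 1 else 0)) := by
  induction hQ : quantile s p β using EReal.rec with
  | bot =>
    obtain ⟨q, hq⟩ : ∃ q, ∀ i, q < s i := by
      obtain ⟨q, hq⟩ := (Set.finite_range s).bddBelow
      exact ⟨q - 1, fun i => by linarith [hq ⟨i, rfl⟩]⟩
    have h := le_sum_of_quantile_lt (s := s) (β := β) hp (q := q) (by
      rw [hQ]; exact EReal.bot_lt_coe q)
    rw [Finset.sum_eq_zero fun i _ => by rw [if_neg (not_le.2 (hq i)), mul_zero]] at h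
    exact (min_le_left _ _).trans (h.trans (le_max_left _ _))
  | coe q =>
    -- Right continuity: a threshold just above `q` already meets the level and selects the same
    -- values.
    obtain ⟨q', hqq', hq'⟩ := exists_gt_forall_le_imp_le s q
    have h := le_sum_of_quantile_lt (s := s) (β := β) hp (q := q') (by
      rw [hQ]; exact_mod_cast hqq')
    refine (min_le_left _ _).trans (h.trans (le_max_of_le_right (le_of_eq ?_)))
    refine Finset.sum_congr rfl fun i _ => ?_
    have : s i ≤ q' ↔ (s i : EReal) ≤ q := by
      rw [EReal.coe_le_coe_iff]
      exact ⟨hq' i, fun h => h.trans hqq'.le⟩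
    simp only [this]
  | top => simp

/-- For distinct values, the weight of the values up to the quantile exceeds the level by at most
the largest weight. -/
lemma sum_quantile_le (hs : Function.Injective s) {M : ℝ} (hM : 0 ≤ M)
    (hpM : ∀ i, p i ≤ M) (hβ : 0 ≤ β) (hβ1 : β ≤ ∑ i, p i) :
    ∑ i, p i * (if (s i : EReal) ≤ quantile s p β then 1 else 0) ≤ β + M := by
  induction hQ : quantile s p β using EReal.rec with
  | bot => simp; linarith
  | coe q =>
    -- Just below `q` the sum is under the level, and by injectivity at most one value enters at
    -- `q`.
    obtain ⟨q', hqq', hq'⟩ := exists_lt_forall_lt_imp_le s q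
    have h := sum_lt_of_lt_quantile (s := s) (p := p) (β := β) (q := q') (by
      rw [hQ]; exact_mod_cast hqq')
    have hsplit : ∀ i, p i * (if (s i : EReal) ≤ q then 1 else 0)
        ≤ p i * (if s i ≤ q' then 1 else 0) + if s i = q then M else 0 := by
      intro i
      rcases lt_trichotomy (s i) q with h1 | h1 | h1
      · have h2 : (s i : EReal) ≤ q := by exact_mod_cast h1.le
        rw [if_pos h2, if_pos (hq' i h1), if_neg h1.ne, add_zero]
      · have h2 : ¬ s i ≤ q' := by rw [h1]; exact not_le.2 hqq'
        have h3 : (s i : EReal) ≤ q := by exact_mod_cast h1.le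
        rw [if_pos h3, if_neg h2, if_pos h1]
        linarith [hpM i]
      · have h2 : ¬ (s i : EReal) ≤ q := by
          rw [EReal.coe_le_coe_iff]; exact not_le.2 h1
        have h3 : ¬ s i ≤ q' := by linarith
        rw [if_neg h2, if_neg h3, if_neg h1.ne']
        simp
    have hone : ∑ i, (if s i = q then M else 0) ≤ M := by
      by_cases hex : ∃ i, s i = q
      · obtain ⟨i, hi⟩ := hex
        rw [Finset.sum_eq_single i]
        · rw [if_pos hi]
        · intro j _ hj
          rw [if_neg fun h => hj (hs (h.trans hi.symm))]
        · simp
      · push Not at hex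
        rw [Finset.sum_eq_zero fun i _ => if_neg (hex i)]
        exact hM
    have := Finset.sum_le_sum fun i (_ : i ∈ Finset.univ) => hsplit i
    rw [Finset.sum_add_distrib] at this
    linarith
  | top =>
    -- An infinite quantile is excluded: at an upper bound of the values the sum is the total
    -- weight, which reaches the level.
    obtain ⟨q, hq⟩ := (Set.finite_range s).bddAbove
    have h := sum_lt_of_lt_quantile (s := s) (p := p) (β := β) (q := q) (by
      rw [hQ]; exact EReal.coe_lt_top q)
    have h' : ∑ i, p i * (if s i ≤ q then 1 else 0) = ∑ i, p i :=
      Finset.sum_congr rfl fun i _ => by rw [if_pos (hq ⟨i, rfl⟩), mul_one]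
    rw [h'] at h
    linarith

end Quantile

/-! ### Weighted coverage of the prediction set -/

section Conformal

variable {𝒳 : Type*} {n c r : ℕ} {α : ℝ} {S : 𝒳 × Fin c → ℝ} {x : Fin n → 𝒳}
  {w : Fin n × Fin c → ℝ} {B : Matrix (Fin r) (Fin n × Fin c) ℝ} {b : Fin r → ℝ}

lemma weightedCover_predictionSet :
    weightedCover x w (predictionSet α S x w)
      = ∑ p, w p / n * (if (S (x p.1, p.2) : EReal) ≤ conformalQuantile α S x w
          then 1 else 0) := by
  classical
  rw [weightedCover, Finset.mul_sum]
  refine Finset.sum_congr rfl fun p _ => ?_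
  simp only [coverIndicator, predictionSet, Set.indicator_apply, Set.mem_ofPred_eq,
    Pi.one_apply]
  ring

lemma sum_weights_div (hn : 0 < n) (hw : w ∈ feasibleSet B b) :
    ∑ p, w p / (n : ℝ) = 1 := by
  have hn' : (n : ℝ) ≠ 0 := by exact_mod_cast hn.ne'
  rw [← Finset.sum_div, Fintype.sum_prod_type, Finset.sum_congr rfl fun i _ => hw.2.1 i]
  simp [hn']

/-- Both the level `(1 - α)(1 + 1/n)` and the total weight `1` are at least `1 - α`; this covers
small `α`, where the level exceeds one. -/
lemma one_sub_le_weightedCover (hn : 0 < n) (hα : α ∈ Set.Icc (0 : ℝ) 1)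
    (hw : w ∈ feasibleSet B b) :
    1 - α ≤ weightedCover x w (predictionSet α S x w) := by
  have hp : ∀ p, 0 ≤ w p / (n : ℝ) := fun p => div_nonneg (hw.1 p) (by positivity)
  have h := min_le_sum_quantile (s := fun p : Fin n × Fin c => S (x p.1, p.2))
    (β := (1 - α) * (1 + 1 / (n : ℝ))) hp
  rw [sum_weights_div hn hw] at h
  have hnn : 0 ≤ weightedCover x w (predictionSet α S x w) :=
    mul_nonneg (by positivity)
      (Finset.sum_nonneg fun p _ => mul_nonneg (hw.1 p) (coverIndicator_nonneg _ _))
  rw [weightedCover_predictionSet, conformalQuantile] at hnn ⊢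
  rw [max_eq_right hnn] at h
  refine le_trans (le_min ?_ (by linarith [hα.1])) h
  exact le_mul_of_one_le_right (by linarith [hα.2]) (by simp)

/-- Each weight is at most `1/n`, so the overshoot is at most `1/n`. The slack left in the claimed
bound is `(α(n+1) - 2) / (n(n+1))`, nonnegative by `hα2`, which also keeps the level below the total
weight. -/
lemma weightedCover_le (hn : 0 < n) (hα : α ∈ Set.Icc (0 : ℝ) 1) (hw : w ∈ feasibleSet B b)
    (hinj : Function.Injective fun p : Fin n × Fin c => S (x p.1, p.2))
    (hα2 : 2 / ((n : ℝ) + 1) ≤ α) :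
    weightedCover x w (predictionSet α S x w) ≤ 1 - α + 2 / ((n : ℝ) + 1) := by
  have hn' : (0 : ℝ) < n := by exact_mod_cast hn
  have hp : ∀ p, 0 ≤ w p / (n : ℝ) := fun p => div_nonneg (hw.1 p) (by positivity)
  have hα3 : 2 ≤ α * (n + 1) := by rwa [div_le_iff₀ (by positivity)] at hα2
  have hβ1 : (1 - α) * (1 + 1 / (n : ℝ)) ≤ 1 := by
    rw [show (1 - α) * (1 + 1 / (n : ℝ)) = (n + 1 - α * (n + 1)) / n by field_simp,
      div_le_one hn']
    linarith
  rw [weightedCover_predictionSet]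
  refine (sum_quantile_le (M := 1 / (n : ℝ)) hinj (by positivity) (fun p => ?_) ?_ ?_).trans ?_
  · exact div_le_div_of_nonneg_right (le_one_of_mem_feasibleSet hw p) hn'.le
  · exact mul_nonneg (by linarith [hα.2]) (by positivity)
  · rwa [sum_weights_div hn hw]
  · have : 1 - α + 2 / ((n : ℝ) + 1) - ((1 - α) * (1 + 1 / (n : ℝ)) + 1 / n)
        = (α * (n + 1) - 2) / (n * (n + 1)) := by field_simp; ring
    have h2 : 0 ≤ (α * (n + 1) - 2) / (n * (n + 1)) :=
      div_nonneg (by linarith) (by positivity)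
    linarith

end Conformal

/-! ### Uniform deviations over thresholds of a score -/

section Threshold

variable {E : Type*} {n : ℕ} {S : E → ℝ} {z : Fin n → E} {ε : ℝ}

lemma empFreq_mono {A A' : Set E} (h : A ⊆ A') : empFreq z A ≤ empFreq z A' :=
  mul_le_mul_of_nonneg_left (Finset.sum_le_sum fun i _ =>
    Set.indicator_le_indicator_of_subset h (fun _ => zero_le_one) (z i)) (by positivity)

lemma empFreq_add_empFreq_compl (hn : 0 < n) (A : Set E) : empFreq z A + empFreq z Aᶜ = 1 := by
  classical
  have hn' : (n : ℝ) ≠ 0 := by exact_mod_cast hn.ne'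
  rw [empFreq, empFreq, ← mul_add, ← Finset.sum_add_distrib]
  have : ∀ i, A.indicator (1 : E → ℝ) (z i) + Aᶜ.indicator 1 (z i) = 1 := fun i =>
    Set.indicator_self_add_compl_apply A 1 (z i)
  simp [this, hn']

variable [MeasurableSpace E] {P : Measure E} [IsProbabilityMeasure P]

/-- Rational thresholds suffice: the distribution function is right continuous and the empirical
frequency is monotone. -/
lemma empFreq_sublevel_le (hS : Measurable S) (hε : 0 ≤ ε)
    (h : ∀ q : ℚ, empFreq z {y | S y ≤ q} < P.real {y | S y ≤ q} + ε) (e : EReal) :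
    empFreq z {y | (S y : EReal) ≤ e} ≤ P.real {y | (S y : EReal) ≤ e} + ε := by
  induction e using EReal.rec with
  | bot => simp [empFreq, hε]
  | coe r =>
    simp only [EReal.coe_le_coe_iff]
    have := Measure.isProbabilityMeasure_map (μ := P) hS.aemeasurable
    have hcdf : ∀ t : ℝ, cdf (P.map S) t = P.real {y | S y ≤ t} := fun t => by
      rw [cdf_eq_real, map_measureReal_apply hS measurableSet_Iic]
      rfl
    rw [← hcdf, ← (cdf (P.map S)).iInf_rat_gt_eq r, ← sub_le_iff_le_add]
    have : Nonempty {q : ℚ // r < q} := ⟨(exists_rat_gt r).choose, (exists_rat_gt r).choose_spec⟩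
    refine le_ciInf fun q => ?_
    rw [hcdf]
    have h1 := h q.1
    have h2 : empFreq z {y | S y ≤ r} ≤ empFreq z {y | S y ≤ (q.1 : ℝ)} :=
      empFreq_mono fun y (hy : S y ≤ r) => hy.trans q.2.le
    linarith
  | top =>
    have hu : {y | (S y : EReal) ≤ ⊤} = Set.univ := by ext y; simp
    rw [hu, probReal_univ]
    rcases Nat.eq_zero_or_pos n with rfl | hn
    · simp [empFreq]; linarith
    · linarith [empFreq_le_one hn z Set.univ]

/-- The opposite deviation is an upper deviation of the complements. A rational just above `r` that
separates the same sample points leaves the empirical frequency unchanged. -/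
lemma measureReal_sublevel_le (hn : 0 < n) (hS : Measurable S) (hε : 0 ≤ ε)
    (h : ∀ q : ℚ, empFreq z {y | (q : ℝ) < S y} < P.real {y | (q : ℝ) < S y} + ε) (e : EReal) :
    P.real {y | (S y : EReal) ≤ e} ≤ empFreq z {y | (S y : EReal) ≤ e} + ε := by
  induction e using EReal.rec with
  | bot => simp [empFreq, hε]
  | coe r =>
    simp only [EReal.coe_le_coe_iff]
    obtain ⟨q', hq', hsep⟩ := exists_gt_forall_le_imp_le (fun i => S (z i)) r
    obtain ⟨q, hrq, hqq'⟩ := exists_rat_btwn hq'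
    have hc : ∀ t : ℝ, {y | S y ≤ t}ᶜ = {y | t < S y} := fun t => by
      ext y; simp
    have h1 : P.real {y | S y ≤ r} ≤ P.real {y | S y ≤ (q : ℝ)} :=
      measureReal_mono fun y (hy : S y ≤ r) => hy.trans hrq.le
    have h2 : P.real {y | S y ≤ (q : ℝ)}ᶜ = 1 - P.real {y | S y ≤ (q : ℝ)} :=
      probReal_compl_eq_one_sub (hS measurableSet_Iic)
    rw [hc] at h2
    have h3 := empFreq_add_empFreq_compl (z := z) hn {y | S y ≤ (q : ℝ)}
    rw [hc] at h3
    have h4 : empFreq z {y | S y ≤ (q : ℝ)} = empFreq z {y | S y ≤ r} := by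
      have : ∀ i, S (z i) ≤ q ↔ S (z i) ≤ r := fun i =>
        ⟨fun h => hsep i (h.trans hqq'.le), fun h => h.trans hrq.le⟩
      simp [empFreq, Set.indicator_apply, this]
    linarith [h q]
  | top =>
    have h1 := empFreq_add_empFreq_compl (z := z) hn Set.univ
    have h2 : empFreq z (∅ : Set E) = 0 := by simp [empFreq]
    rw [Set.compl_univ, h2, add_zero] at h1
    have hu : {y | (S y : EReal) ≤ ⊤} = Set.univ := by ext y; simp
    rw [hu, probReal_univ, h1]
    linarith

/-- The set of samples whose empirical frequencies exceed, by at least `ε`, the probabilities of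
the sections of the sets `A k` at the first component. -/
def deviationSet {T ι : Type*} (P : Measure E) (A : ι → Set (T × E)) (n : ℕ) (ε : ℝ) :
    Set (T × (Fin n → E)) :=
  {p | ∃ k, P.real (Prod.mk p.1 ⁻¹' A k) + ε ≤ empFreq p.2 (Prod.mk p.1 ⁻¹' A k)}

variable {T ι : Type*} [MeasurableSpace T] [Countable ι] {A : ι → Set (T × E)}

lemma measurableSet_deviationSet (hAm : ∀ k, MeasurableSet (A k)) :
    MeasurableSet (deviationSet P A n ε) := by
  have : deviationSet P A n ε = ⋃ k, {p : T × (Fin n → E) |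
      P.real (Prod.mk p.1 ⁻¹' A k) + ε ≤ empFreq p.2 (Prod.mk p.1 ⁻¹' A k)} := by
    ext p; simp [deviationSet]
  rw [this]
  refine .iUnion fun k => measurableSet_le ?_ ?_
  · exact ((measurable_measure_prodMk_left (hAm k)).ennreal_toReal.comp measurable_fst).add_const _
  · have h : ∀ i, Measurable fun p : T × (Fin n → E) =>
        (A k).indicator (1 : T × E → ℝ) (p.1, p.2 i) := fun i =>
      (measurable_one.indicator (hAm k)).comp
        (measurable_fst.prodMk ((measurable_pi_apply i).comp measurable_snd))
    exact (Finset.measurable_sum _ fun i _ => h i).const_mul _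

/-- The Dvoretzky–Kiefer–Wolfowitz–Massart inequality for a chain of sets that depends on an
independent variable. -/
lemma measure_deviationSet_le [LinearOrder ι] (Q : Measure T) [IsProbabilityMeasure Q]
    (hAm : ∀ k, MeasurableSet (A k)) (hA : Monotone A) (hn : 0 < n) (hε : 0 < ε) :
    (Q.prod (Measure.pi fun _ : Fin n => P)) (deviationSet P A n ε)
      ≤ ENNReal.ofReal (Real.exp (-(2 * n * ε ^ 2))) := by
  -- Fubini: with the independent variable frozen, the sections form a fixed chain.
  rw [Measure.prod_apply (measurableSet_deviationSet hAm)]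
  calc _ ≤ ∫⁻ _, ENNReal.ofReal (Real.exp (-(2 * n * ε ^ 2))) ∂Q := by
        refine lintegral_mono fun t => ?_
        exact measure_exists_le_empFreq P (A := fun k => Prod.mk t ⁻¹' A k)
          (fun j k hjk => Set.preimage_mono (hA hjk))
          (fun k => measurable_prodMk_left (hAm k)) hn hε
    _ = _ := by simp

end Threshold

/-! ### Union bound for two bad events, and the joint law of the samples -/

section Probability

variable {Ω E : Type*} [MeasurableSpace Ω] [MeasurableSpace E] {μ : Measure Ω}
  [IsProbabilityMeasure μ]

/-- The property `p` need not be measurable, so its exceptional null set is enlarged to a measurable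
one before taking complements. -/
lemma holdsWithProb_of_two_events {δ : ℝ} (hδ : 0 ≤ δ) {p : Ω → Prop} {A₁ A₂ : Set Ω}
    (hm₁ : MeasurableSet A₁) (hm₂ : MeasurableSet A₂) (h₁ : μ A₁ ≤ ENNReal.ofReal (δ / 2))
    (h₂ : μ A₂ ≤ ENNReal.ofReal (δ / 2)) (hp : ∀ᵐ ω ∂μ, ω ∉ A₁ → ω ∉ A₂ → p ω) :
    HoldsWithProb μ (1 - δ) p := by
  set N := toMeasurable μ {ω | ¬ (ω ∉ A₁ → ω ∉ A₂ → p ω)} with hN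
  have hN0 : μ N = 0 := by rw [hN, measure_toMeasurable]; exact hp
  have hm : MeasurableSet (A₁ ∪ A₂ ∪ N) := (hm₁.union hm₂).union (measurableSet_toMeasurable _ _)
  refine ⟨(A₁ ∪ A₂ ∪ N)ᶜ, hm.compl, ?_, ?_⟩
  · have hle : μ (A₁ ∪ A₂ ∪ N) ≤ ENNReal.ofReal δ := by
      calc μ (A₁ ∪ A₂ ∪ N) ≤ μ A₁ + μ A₂ + μ N :=
            (measure_union_le _ _).trans (add_le_add (measure_union_le _ _) le_rfl)
        _ ≤ ENNReal.ofReal (δ / 2) + ENNReal.ofReal (δ / 2) := by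
            rw [hN0, add_zero]; exact add_le_add h₁ h₂
        _ = ENNReal.ofReal δ := by
            rw [← ENNReal.ofReal_add (by positivity) (by positivity), add_halves]
    rw [prob_compl_eq_one_sub hm, ENNReal.ofReal_sub _ hδ, ENNReal.ofReal_one]
    exact tsub_le_tsub_left hle 1
  · intro ω hω
    simp only [Set.mem_compl_iff, Set.mem_union, not_or] at hω
    by_contra hc
    exact hω.2 (subset_toMeasurable _ _ fun h => hc (h hω.1.1 hω.1.2))

variable {m n : ℕ} {P : Measure E} {Ztr : Fin m → Ω → E}
  {Zcal : Fin n → Ω → E}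

lemma map_sum_elim_eq_pi (hZtr : ∀ j, Measurable (Ztr j)) (hZcal : ∀ i, Measurable (Zcal i))
    (hindep : iIndepFun (Sum.elim Ztr Zcal) μ)
    (hlawtr : ∀ j, μ.map (Ztr j) = P) (hlawcal : ∀ i, μ.map (Zcal i) = P) :
    μ.map (fun ω => Sum.elim (fun j => Ztr j ω) fun i => Zcal i ω)
      = Measure.pi fun _ : Fin m ⊕ Fin n => P := by
  have hm : ∀ i, Measurable (Sum.elim Ztr Zcal i) := by
    rintro (j | i)
    · exact hZtr j
    · exact hZcal i
  have h := (iIndepFun_iff_map_fun_eq_pi_map fun i => (hm i).aemeasurable).1 hindep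
  have h1 : (fun ω => Sum.elim (fun j => Ztr j ω) fun i => Zcal i ω)
      = fun ω i => Sum.elim Ztr Zcal i ω := by
    funext ω i
    rcases i with j | i <;> rfl
  have h2 : (fun i => μ.map (Sum.elim Ztr Zcal i)) = fun _ => P := by
    funext i
    rcases i with j | i
    · exact hlawtr j
    · exact hlawcal i
  rw [h1, h, h2]

lemma map_prodMk_eq_prod_pi [IsProbabilityMeasure P] (hZtr : ∀ j, Measurable (Ztr j))
    (hZcal : ∀ i, Measurable (Zcal i))
    (hindep : iIndepFun (Sum.elim Ztr Zcal) μ)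
    (hlawtr : ∀ j, μ.map (Ztr j) = P) (hlawcal : ∀ i, μ.map (Zcal i) = P) :
    μ.map (fun ω => (fun j => Ztr j ω, fun i => Zcal i ω))
      = (Measure.pi fun _ : Fin m => P).prod (Measure.pi fun _ : Fin n => P) := by
  have hm : Measurable fun ω => (Sum.elim (fun j => Ztr j ω) fun i => Zcal i ω :
      Fin m ⊕ Fin n → E) := by
    refine measurable_pi_iff.2 ?_
    rintro (j | i)
    · exact hZtr j
    · exact hZcal i
  have hmp := measurePreserving_sumPiEquivProdPi fun _ : Fin m ⊕ Fin n => P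
  rw [← hmp.map_eq, ← map_sum_elim_eq_pi hZtr hZcal hindep hlawtr hlawcal,
    Measure.map_map hmp.measurable hm]
  rfl

end Probability

/-! ### Training-conditional coverage -/

/-- Up to an event of small probability, the kernel objective of the true-label weights is small. -/
lemma measure_kernelObjective_trueWeights_le {Ω 𝒳 H : Type*} [MeasurableSpace Ω]
    [MeasurableSpace 𝒳] {n m c : ℕ} (hn : 0 < n) (hm : 0 < m) [NormedAddCommGroup H]
    [InnerProductSpace ℝ H] [CompleteSpace H] [RKHS ℝ H (𝒳 × Fin c) ℝ]
    (hKmeas : Measurable fun z : (𝒳 × Fin c) × (𝒳 × Fin c) => realKernel H z.1 z.2)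
    {κ : ℝ} (hκ : 0 ≤ κ)
    (hK : ∀ z z' : 𝒳 × Fin c, 0 ≤ realKernel H z z' ∧ realKernel H z z' ≤ κ ^ 2)
    {μ : Measure Ω} [IsProbabilityMeasure μ] {P : Measure (𝒳 × Fin c)} [IsProbabilityMeasure P]
    {Ztr : Fin m → Ω → 𝒳 × Fin c} {Zcal : Fin n → Ω → 𝒳 × Fin c}
    (hZtr : ∀ j, Measurable (Ztr j)) (hZcal : ∀ i, Measurable (Zcal i))
    (hindep : iIndepFun (Sum.elim Ztr Zcal) μ)
    (hlawtr : ∀ j, μ.map (Ztr j) = P) (hlawcal : ∀ i, μ.map (Zcal i) = P)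
    {L : ℝ} (hL : 0 ≤ L) :
    ∃ A : Set Ω, MeasurableSet A ∧ μ A ≤ ENNReal.ofReal (Real.exp (-L)) ∧ ∀ ω, ω ∉ A →
      kernelObjective H (fun i => (Zcal i ω).1) (fun j => Ztr j ω)
        (trueWeights fun i => Zcal i ω) ≤ κ * (1 + √L) * √(1 / (n : ℝ) + 1 / (m : ℝ)) := by
  set T : Ω → Fin m ⊕ Fin n → 𝒳 × Fin c :=
    fun ω => Sum.elim (fun j => Ztr j ω) fun i => Zcal i ω with hT
  have hTm : Measurable T := by
    refine measurable_pi_iff.2 ?_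
    rintro (j | i)
    · exact hZtr j
    · exact hZcal i
  set D : Set (Fin m ⊕ Fin n → 𝒳 × Fin c) :=
    {z | κ * (1 + √L) * √(∑ i, twoSampleCoeff n m i ^ 2)
      < embeddingNorm H (twoSampleCoeff n m) z} with hD
  have hDm : MeasurableSet D :=
    measurableSet_lt measurable_const (measurable_embeddingNorm hKmeas _)
  refine ⟨T ⁻¹' D, hTm hDm, ?_, fun ω hω => ?_⟩
  · rw [← Measure.map_apply hTm hDm,
      map_sum_elim_eq_pi hZtr hZcal hindep hlawtr hlawcal]
    exact measure_lt_embeddingNorm_le hκ hK hKmeas P (sum_twoSampleCoeff hn hm) hL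
  · have h : ¬ κ * (1 + √L) * √(∑ i, twoSampleCoeff n m i ^ 2)
      < embeddingNorm H (twoSampleCoeff n m) (T ω) := hω
    rw [not_lt, sum_twoSampleCoeff_sq hn hm] at h
    rw [kernelObjective_trueWeights]
    exact h

section Deviation

variable {Ω E : Type*} [MeasurableSpace Ω] [MeasurableSpace E] {n m : ℕ} {μ : Measure Ω}
  [IsProbabilityMeasure μ] {P : Measure E} [IsProbabilityMeasure P] {Ztr : Fin m → Ω → E}
  {Zcal : Fin n → Ω → E}

lemma exists_deviation_event {ι : Type*} [Countable ι] [LinearOrder ι] (hn : 0 < n)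
    (hZtr : ∀ j, Measurable (Ztr j)) (hZcal : ∀ i, Measurable (Zcal i))
    (hindep : iIndepFun (Sum.elim Ztr Zcal) μ)
    (hlawtr : ∀ j, μ.map (Ztr j) = P) (hlawcal : ∀ i, μ.map (Zcal i) = P)
    {A : ι → Set ((Fin m → E) × E)} (hAm : ∀ k, MeasurableSet (A k)) (hA : Monotone A)
    {ε : ℝ} (hε : 0 < ε) :
    ∃ D : Set Ω, MeasurableSet D ∧ μ D ≤ ENNReal.ofReal (Real.exp (-(2 * n * ε ^ 2))) ∧
      ∀ ω, ω ∉ D → ∀ k, empFreq (fun i => Zcal i ω) {y | (fun j => Ztr j ω, y) ∈ A k}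
        < P.real {y | (fun j => Ztr j ω, y) ∈ A k} + ε := by
  have hTm : Measurable fun ω => (fun j => Ztr j ω, fun i => Zcal i ω) :=
    (measurable_pi_iff.2 hZtr).prodMk (measurable_pi_iff.2 hZcal)
  have hDm := measurableSet_deviationSet (P := P) (n := n) (ε := ε) hAm
  refine ⟨_, hTm hDm, ?_, fun ω hω k => ?_⟩
  · rw [← Measure.map_apply hTm hDm,
      map_prodMk_eq_prod_pi hZtr hZcal hindep hlawtr hlawcal]
    exact measure_deviationSet_le _ hAm hA hn hε
  · by_contra! h
    exact hω ⟨k, h⟩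

variable {S : (Fin m → E) → E → ℝ}

/-- Uniform upper deviations of the empirical distribution function of the scores. -/
lemma exists_empFreq_sublevel_le_event (hn : 0 < n) (hZtr : ∀ j, Measurable (Ztr j))
    (hZcal : ∀ i, Measurable (Zcal i)) (hindep : iIndepFun (Sum.elim Ztr Zcal) μ)
    (hlawtr : ∀ j, μ.map (Ztr j) = P) (hlawcal : ∀ i, μ.map (Zcal i) = P)
    (hS : Measurable fun t : (Fin m → E) × E => S t.1 t.2) {ε : ℝ} (hε : 0 < ε) :
    ∃ D : Set Ω, MeasurableSet D ∧ μ D ≤ ENNReal.ofReal (Real.exp (-(2 * n * ε ^ 2))) ∧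
      ∀ ω, ω ∉ D → ∀ e : EReal,
        empFreq (fun i => Zcal i ω) {y | (S (fun j => Ztr j ω) y : EReal) ≤ e}
          ≤ P.real {y | (S (fun j => Ztr j ω) y : EReal) ≤ e} + ε := by
  obtain ⟨D, hDm, hD, h⟩ := exists_deviation_event hn hZtr hZcal hindep hlawtr hlawcal
    (A := fun q : ℚ => {t : (Fin m → E) × E | S t.1 t.2 ≤ q})
    (fun q => measurableSet_le hS measurable_const)
    (fun q q' hqq' t (ht : S t.1 t.2 ≤ q) => ht.trans (by exact_mod_cast hqq')) hε
  exact ⟨D, hDm, hD, fun ω hω e =>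
    empFreq_sublevel_le (hS.comp measurable_prodMk_left) hε.le (h ω hω) e⟩

/-- Uniform lower deviations of the empirical distribution function of the scores. -/
lemma exists_measureReal_sublevel_le_event (hn : 0 < n) (hZtr : ∀ j, Measurable (Ztr j))
    (hZcal : ∀ i, Measurable (Zcal i)) (hindep : iIndepFun (Sum.elim Ztr Zcal) μ)
    (hlawtr : ∀ j, μ.map (Ztr j) = P) (hlawcal : ∀ i, μ.map (Zcal i) = P)
    (hS : Measurable fun t : (Fin m → E) × E => S t.1 t.2) {ε : ℝ} (hε : 0 < ε) :
    ∃ D : Set Ω, MeasurableSet D ∧ μ D ≤ ENNReal.ofReal (Real.exp (-(2 * n * ε ^ 2))) ∧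
      ∀ ω, ω ∉ D → ∀ e : EReal,
        P.real {y | (S (fun j => Ztr j ω) y : EReal) ≤ e}
          ≤ empFreq (fun i => Zcal i ω) {y | (S (fun j => Ztr j ω) y : EReal) ≤ e} + ε := by
  -- Strict superlevel sets decrease in the threshold; reversing the order of `ℚ` makes them an
  -- increasing chain.
  have : Countable ℚᵒᵈ := inferInstanceAs (Countable ℚ)
  obtain ⟨D, hDm, hD, h⟩ := exists_deviation_event hn hZtr hZcal hindep hlawtr hlawcal
    (A := fun q : ℚᵒᵈ => {t : (Fin m → E) × E | ((OrderDual.ofDual q : ℚ) : ℝ) < S t.1 t.2})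
    (fun q => measurableSet_lt measurable_const hS)
    (fun q q' hqq' t (ht : ((OrderDual.ofDual q : ℚ) : ℝ) < S t.1 t.2) =>
      lt_of_le_of_lt (by exact_mod_cast hqq') ht) hε
  exact ⟨D, hDm, hD, fun ω hω e => measureReal_sublevel_le hn (hS.comp measurable_prodMk_left)
    hε.le (fun q => h ω hω (OrderDual.toDual q)) e⟩

end Deviation

end UnsupConformal

end

open UnsupConformal in
theorem theorem2
    {Ω 𝒳 H : Type*} [MeasurableSpace Ω] [MeasurableSpace 𝒳] {n m c r : ℕ}
    (hn : 0 < n) (hm : 0 < m)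
    -- the RKHS and its kernel
    [NormedAddCommGroup H] [InnerProductSpace ℝ H] [CompleteSpace H] [RKHS ℝ H (𝒳 × Fin c) ℝ]
    (hKmeas : Measurable fun z : (𝒳 × Fin c) × (𝒳 × Fin c) =>
      UnsupConformal.realKernel H z.1 z.2)
    (κ : ℝ) (hκ : 0 ≤ κ)
    (hK : ∀ z z' : 𝒳 × Fin c, 0 ≤ UnsupConformal.realKernel H z z' ∧
      UnsupConformal.realKernel H z z' ≤ κ ^ 2)
    -- the data distribution `P`, and i.i.d. training and calibration samples drawn from it
    (μ : Measure Ω) [IsProbabilityMeasure μ]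
    (P : Measure (𝒳 × Fin c)) [IsProbabilityMeasure P]
    (Ztr : Fin m → Ω → 𝒳 × Fin c) (Zcal : Fin n → Ω → 𝒳 × Fin c)
    (hZtr : ∀ j, Measurable (Ztr j)) (hZcal : ∀ i, Measurable (Zcal i))
    (hindep : iIndepFun (Sum.elim Ztr Zcal) μ)
    (hlawtr : ∀ j, μ.map (Ztr j) = P) (hlawcal : ∀ i, μ.map (Zcal i) = P)
    -- the conformal score, constructed from the training samples
    (S : (Fin m → 𝒳 × Fin c) → 𝒳 × Fin c → ℝ)
    (hS : Measurable fun t : (Fin m → 𝒳 × Fin c) × (𝒳 × Fin c) => S t.1 t.2)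
    -- the linear constraints, satisfied by the true-label weights, and the label weights
    (B : Ω → Matrix (Fin r) (Fin n × Fin c) ℝ) (b : Ω → Fin r → ℝ)
    (htrue : ∀ᵐ ω ∂μ, UnsupConformal.trueWeights (fun i => Zcal i ω) ∈
      UnsupConformal.feasibleSet (B ω) (b ω))
    (w : Ω → Fin n × Fin c → ℝ)
    (hw : ∀ᵐ ω ∂μ, UnsupConformal.IsKernelSolution H (fun i => (Zcal i ω).1)
      (fun j => Ztr j ω) (B ω) (b ω) (w ω))
    (α : ℝ) (hα : α ∈ Set.Icc (0 : ℝ) 1) (δ : ℝ) (hδ : δ ∈ Set.Ioo (0 : ℝ) 1)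
    -- the set-prediction rule and the excess gap
    (C : Ω → 𝒳 → Set (Fin c))
    (hC : ∀ ω, C ω = UnsupConformal.predictionSet α (S fun j => Ztr j ω)
      (fun i => (Zcal i ω).1) (w ω))
    (G : Ω → ℝ)
    (hG : ∀ ω, G ω = UnsupConformal.kernelGap H m κ δ (fun i => (Zcal i ω).1) (C ω)) :
    -- the minimum that defines the gap is attained
    (∀ ω, ∃ f : H, UnsupConformal.approxError (fun i => (Zcal i ω).1) (C ω) f
        + UnsupConformal.varianceFactor n m κ δ * ‖f‖ = G ω) ∧
    -- the gap is the optimum of the bias-variance trade-off over all radii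
    (∀ ω, IsGLB ((fun R : ℝ => UnsupConformal.ballBias H (fun i => (Zcal i ω).1) (C ω) R
        + UnsupConformal.varianceFactor n m κ δ * R) '' Set.Ioi 0) (G ω)) ∧
    -- lower bound for the training-conditional coverage
    UnsupConformal.HoldsWithProb μ (1 - δ) (fun ω =>
      1 - α - G ω - √(Real.log (2 / δ) / (2 * n)) ≤ UnsupConformal.coverage P (C ω)) ∧
    -- upper bound for the training-conditional coverage
    ((∀ᵐ ω ∂μ, Function.Injective fun p : Fin n × Fin c =>
        S (fun j => Ztr j ω) ((Zcal p.1 ω).1, p.2)) →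
      UnsupConformal.HoldsWithProb μ (1 - δ) (fun ω =>
        UnsupConformal.coverage P (C ω) ≤
          1 - α + 2 / ((n : ℝ) + 1) + G ω + √(Real.log (2 / δ) / (2 * n)))) := by
  have hKd : ∀ z : 𝒳 × Fin c, realKernel H z z ≤ κ ^ 2 := fun z => (hK z z).2
  obtain ⟨hδ0, hδ1⟩ := hδ
  have hn' : (0 : ℝ) < n := by exact_mod_cast hn
  set L := Real.log (2 / δ) with hL
  have hL0 : 0 < L := Real.log_pos (by rw [lt_div_iff₀ hδ0]; linarith)
  have hexpL : Real.exp (-L) = δ / 2 := by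
    rw [hL, ← Real.log_inv, inv_div, Real.exp_log (by positivity)]
  -- Chosen so that `exp (-2nε²) = exp (-L) = δ / 2`: the deviation event and the embedding event
  -- share the failure probability equally.
  set ε := √(L / (2 * n)) with hε
  have hε0 : 0 < ε := Real.sqrt_pos.2 (by positivity)
  have hεL : Real.exp (-(2 * n * ε ^ 2)) = δ / 2 := by
    rw [hε, Real.sq_sqrt (by positivity), mul_div_cancel₀ _ (by positivity), hexpL]
  obtain ⟨A, hAm, hA, hAobj⟩ := measure_kernelObjective_trueWeights_le hn hm hKmeas hκ hK hZtr
    hZcal hindep hlawtr hlawcal hL0.le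
  rw [hexpL] at hA
  have hgap : ∀ ω, ω ∉ A → trueWeights (fun i => Zcal i ω) ∈ feasibleSet (B ω) (b ω) →
      IsKernelSolution H (fun i => (Zcal i ω).1) (fun j => Ztr j ω) (B ω) (b ω) (w ω) →
      |weightedCover (fun i => (Zcal i ω).1) (w ω) (C ω)
        - empFreq (fun i => Zcal i ω) {z | z.2 ∈ C ω z.1}| ≤ G ω := by
    intro ω hω ht hs
    rw [hG, ← weightedCover_trueWeights]
    exact abs_weightedCover_sub_le_kernelGap hn hκ hKd δ hs ht (C ω) (hAobj ω hω)
  have hset : ∀ ω, {z : 𝒳 × Fin c | z.2 ∈ C ω z.1}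
      = {z | (S (fun j => Ztr j ω) z : EReal) ≤ conformalQuantile α (S fun j => Ztr j ω)
        (fun i => (Zcal i ω).1) (w ω)} := by
    intro ω
    rw [hC]
    rfl
  refine ⟨fun ω => ?_, fun ω => ?_, ?_, fun hinj => ?_⟩
  · rw [hG]
    exact exists_eq_kernelGap hn hκ hKd δ _ _
  · rw [hG]
    exact isGLB_ballBias_add hn hκ hKd δ _ _
  · obtain ⟨D, hDm, hD, hdev⟩ := exists_empFreq_sublevel_le_event hn hZtr hZcal hindep hlawtr
      hlawcal hS hε0
    rw [hεL] at hD
    refine holdsWithProb_of_two_events hδ0.le hAm hDm hA hD ?_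
    filter_upwards [htrue, hw] with ω ht hs hωA hωD
    have h1 := (abs_le.1 (hgap ω hωA ht hs)).2
    have h2 := hdev ω hωD (conformalQuantile α (S fun j => Ztr j ω) (fun i => (Zcal i ω).1) (w ω))
    rw [← hset ω] at h2
    have h3 := one_sub_le_weightedCover (S := S fun j => Ztr j ω) (x := fun i => (Zcal i ω).1)
      hn hα hs.1
    rw [← hC ω] at h3
    rw [coverage]
    linarith
  · obtain ⟨D, hDm, hD, hdev⟩ := exists_measureReal_sublevel_le_event hn hZtr hZcal hindep hlawtr
      hlawcal hS hε0
    rw [hεL] at hD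
    refine holdsWithProb_of_two_events hδ0.le hAm hDm hA hD ?_
    filter_upwards [htrue, hw, hinj] with ω ht hs hi hωA hωD
    have hG0 : 0 ≤ G ω := by rw [hG]; exact kernelGap_nonneg hκ δ _ _
    -- For `α < 2/(n+1)` the claimed upper bound exceeds one.
    rcases lt_or_ge α (2 / ((n : ℝ) + 1)) with hα2 | hα2
    · have : coverage P (C ω) ≤ 1 := measureReal_le_one
      linarith
    · have h1 := (abs_le.1 (hgap ω hωA ht hs)).1
      have h2 := hdev ω hωD
        (conformalQuantile α (S fun j => Ztr j ω) (fun i => (Zcal i ω).1) (w ω))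
      rw [← hset ω] at h2
      have h3 := weightedCover_le (S := S fun j => Ztr j ω) (x := fun i => (Zcal i ω).1)
        hn hα hs.1 hi hα2
      rw [← hC ω] at h3
      rw [coverage]
      linarith
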